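/- Work with diffeological spaces; subsets carry the subspace diffeology, $X\times Y$ the product diffeology, $I=[0,1]\subset\mathbf R$, and $I^n\subset\mathbf R^n$ is the unit cube with boundary $\partial I^n$ ($\partial I^0=\emptyset$). A pair $(X,A)$ is a diffeological space with a subspace. Two smooth maps of pairs $f_0,f_1\colon(X,A)\to(Y,B)$ are homotopic if there is a smooth $H\colon X\times I\to Y$ with $H(\cdot,0)=f_0$, $H(\cdot,1)=f_1$ and $H(A\times I)\subset B$; $[X,A;Y,B]$ denotes the set of homotopy classes, and $\pi_n(X,x)=[I^n,\partial I^n;X,\{x\}]$ for $n\ge 0$. For an integer $N\ge 0$, a smooth map $\phi\colon X\to Y$ is an $N$-equivalence if for every $x\in X$ the map $\phi_*\colon\pi_n(X,x)\to\pi_n(Y,\phi(x))$ is injective for $0\le n<N$ and surjective for $0\le n\le N$, and if moreover $X\neq\emptyset$ whenever $Y\ne\emptyset$. A smooth map of pairs $\phi\colon(X,A)\to(Y,B)$ is an $N$-equivalence if both $\phi\colon X\to Y$ and its restriction $A\to B$ are $N$-equivalences. A smooth CW complex is a diffeological space $Z$ with skeleta $\emptyset=Z^{-1}\subset Z^0\subset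 Z^1\subset\cdots$ such that each $Z^n$ is a pushout (in diffeological spaces) of $Z^{n-1}$ and $\coprod_{\lambda\in\Lambda_n}I^n$ along attaching maps $\phi_\lambda\colon\partial I^n\to Z^{n-1}$ $(\lambda\in\Lambda_n)$, and $Z=\operatorname{colim}Z^n$; the resulting maps $I^n\to Z^n$ are its characteristic maps. It is gathered if every attaching map is tame, i.e. for some $0<\epsilon\le 1/2$ its value at $(t_1,\dots,t_n)\in\partial I^n$ does not change when a coordinate $t_j$ with $|t_j-\alpha|\le\epsilon$, $\alpha\in\{0,1\}$, is replaced by $\alpha$. A subcomplex of $Z$ is a subspace $C$ that is a smooth CW complex all of whose characteristic maps are characteristic maps of $Z$. A pair of gathered CW complexes $(Z,C)$ is a gathered CW complex $Z$ with a subcomplex $C$ (which is then gathered); its dimension is that of $Z$, so that $\dim(Z,C)\le N$ means $Z=Z^N$ and $\dim(Z,C)<N$ means $Z=Z^{N-1}$. **Proposition.** Let $N\ge0$, let $\phi\colon(X,A)\to(Y,B)$ be an $N$-equivalence between pairs of diffeological spaces and let $(Z,C)$ be a pair of gathered CW complexes. Then the induced map $$\phi_*\colon[Z,C;X,A]\to[Z,C;Y,B],\qquad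 [f]\mapsto[\phi\circ f],$$ is injective if $\dim(Z,C)<N$ and surjective if $\dim(Z,C)\le N$. -/

import Mathlib

open Diffeology

noncomputable section

namespace SmoothHomotopy

universe u v w

/-! ### Subspace, product, final and coproduct diffeologies -/

section Diffeologies

variable {X : Type u} {Y : Type v}

/-- The pullback diffeology along `f : X → Y`: `p` is a plot iff `f ∘ p` is a plot of `Y`. -/
@[reducible]
def inducedDiffeology (f : X → Y) [DiffeologicalSpace Y] : DiffeologicalSpace X where
  plots n := {p : EuclideanSpace ℝ (Fin n) → X | IsPlot (f ∘ p)}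
  constant_plots x := isPlot_const (x := f x)
  plot_reparam {n m p g} hp hg := isPlot_reparam (p := f ∘ p) hp hg
  locality {n p} hp := by
    refine DiffeologicalSpace.locality (p := f ∘ p) fun x => ?_
    obtain ⟨s, hs, hx, h⟩ := hp x
    exact ⟨s, hs, hx, fun {m g} hg hg' => h hg hg'⟩

/-- Subspaces carry the subspace diffeology. -/
instance instSubtype [DiffeologicalSpace X] {P : X → Prop} : DiffeologicalSpace {x // P x} :=
  inducedDiffeology Subtype.val

/-- The product diffeology: a map is a plot iff both of its components are. -/
instance instProd [DiffeologicalSpace X] [DiffeologicalSpace Y] : DiffeologicalSpace (X × Y) where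
  plots n := {p : EuclideanSpace ℝ (Fin n) → X × Y |
    IsPlot (fun r => (p r).1) ∧ IsPlot (fun r => (p r).2)}
  constant_plots x := ⟨isPlot_const (x := x.1), isPlot_const (x := x.2)⟩
  plot_reparam hp hf := ⟨isPlot_reparam hp.1 hf, isPlot_reparam hp.2 hf⟩
  locality {n p} hp := by
    constructor
    · refine DiffeologicalSpace.locality fun x => ?_
      obtain ⟨s, hs, hx, h⟩ := hp x
      exact ⟨s, hs, hx, fun {m g} hg hg' => (h hg hg').1⟩
    · refine DiffeologicalSpace.locality fun x => ?_
      obtain ⟨s, hs, hx, h⟩ := hp x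
      exact ⟨s, hs, hx, fun {m g} hg hg' => (h hg hg').2⟩

/-- The final diffeology defined by a single map `f : X → Y`, i.e. the finest diffeology on `Y`
for which `f` is smooth: it is generated by the maps `f ∘ p` with `p` a plot of `X`. The final
diffeology defined by a family of maps is the supremum of these. -/
@[reducible]
def finalDiffeology [DiffeologicalSpace X] (f : X → Y) : DiffeologicalSpace Y :=
  DiffeologicalSpace.generateFrom
    {q | ∃ p : EuclideanSpace ℝ (Fin q.1) → X, IsPlot p ∧ q.2 = f ∘ p}

/-- The coproduct diffeology on a disjoint union: the final one for the inclusions of the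
summands. -/
instance instSigma {ι : Type u} {S : ι → Type v} [∀ i, DiffeologicalSpace (S i)] :
    DiffeologicalSpace (Σ i, S i) :=
  ⨆ i, finalDiffeology (fun x : S i => (⟨i, x⟩ : Σ i, S i))

end Diffeologies

/-! ### Pushouts of diffeological spaces -/

/-- The elementary identifications `i₁ a ∼ i₂ a` in the disjoint union `X₁ ⨿ X₂`. -/
def GlueRel {S : Type*} {X₁ : Type*} {X₂ : Type*} (i₁ : S → X₁) (i₂ : S → X₂)
    (p q : X₁ ⊕ X₂) : Prop :=
  ∃ a : S, p = Sum.inl (i₁ a) ∧ q = Sum.inr (i₂ a)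

/-- The square of diffeological spaces with `i₁ : S → X₁`, `i₂ : S → X₂`, `f₁ : X₁ → W`,
`f₂ : X₂ → W` is a pushout: it is a commutative square of smooth maps, and `f₁`, `f₂` identify `W`
with the quotient of `X₁ ⨿ X₂` by the smallest equivalence relation with `i₁ a ∼ i₂ a` for all
`a`, where `W` carries the final diffeology defined by `f₁` and `f₂`. -/
structure IsDiffPushout {S : Type*} {X₁ : Type*} {X₂ : Type*} {W : Type*}
    [DiffeologicalSpace S] [DiffeologicalSpace X₁] [DiffeologicalSpace X₂]
    [dW : DiffeologicalSpace W]
    (i₁ : S → X₁) (i₂ : S → X₂) (f₁ : X₁ → W) (f₂ : X₂ → W) : Prop where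
  smooth_left : DSmooth i₁
  smooth_right : DSmooth i₂
  smooth_inl : DSmooth f₁
  smooth_inr : DSmooth f₂
  comm : ∀ a, f₁ (i₁ a) = f₂ (i₂ a)
  surjective : Function.Surjective (Sum.elim f₁ f₂)
  ker : ∀ p q, Sum.elim f₁ f₂ p = Sum.elim f₁ f₂ q → Relation.EqvGen (GlueRel i₁ i₂) p q
  final : dW = finalDiffeology f₁ ⊔ finalDiffeology f₂

/-! ### Cubes and tame maps -/

/-- The cube `Iⁿ`, a subspace of `ℝⁿ`. -/
abbrev ICube (n : ℕ) : Type :=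
  {t : EuclideanSpace ℝ (Fin n) // ∀ i, t i ∈ Set.Icc (0 : ℝ) 1}

/-- The boundary `∂Iⁿ` of the cube (empty for `n = 0`). -/
def cubeBoundary (n : ℕ) : Set (ICube n) :=
  {t | ∃ i, t.1 i = 0 ∨ t.1 i = 1}

/-- A map on `∂Iⁿ` is `ε`-tame if its value does not change when a coordinate at distance at most
`ε` from `α ∈ {0, 1}` is replaced by `α`. -/
def IsTameWith {n : ℕ} {X : Type u} (ε : ℝ) (f : cubeBoundary n → X) : Prop :=
  ∀ (s t : cubeBoundary n) (j : Fin n), (∀ i, i ≠ j → s.1.1 i = t.1.1 i) →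
    (t.1.1 j = 0 ∨ t.1.1 j = 1) → |s.1.1 j - t.1.1 j| ≤ ε → f s = f t

/-- A map on `∂Iⁿ` is tame if it is `ε`-tame for some `0 < ε ≤ 1/2`. -/
def IsTame {n : ℕ} {X : Type u} (f : cubeBoundary n → X) : Prop :=
  ∃ ε : ℝ, 0 < ε ∧ ε ≤ 1 / 2 ∧ IsTameWith ε f

/-! ### Smooth CW complexes -/

/-- A structure of smooth relative CW complex on the pair `(X, A)`. Here `skel n` is the skeleton
`Xⁿ⁻¹`, so that `skel 0 = X⁻¹ = A`. Pushouts along `⨿ ∂Iⁿ ⊆ ⨿ Iⁿ`, and the colimit over all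
skeleta, turn the skeleta into subspaces of `X`, hence they are taken to be subspaces from the
start. -/
structure RelCWComplex (X : Type u) [dX : DiffeologicalSpace X] (A : Set X) where
  /-- `skel n` is the `(n - 1)`-skeleton. -/
  skel : ℕ → Set X
  skel_zero : skel 0 = A
  skel_subset : ∀ n, skel n ⊆ skel (n + 1)
  /-- The set of `n`-cells. -/
  cell : ℕ → Type u
  /-- The attaching maps `∂Iⁿ → Xⁿ⁻¹`. -/
  attach : ∀ n, cell n → cubeBoundary n → skel n
  /-- The characteristic maps `Iⁿ → Xⁿ`. -/
  char : ∀ n, cell n → ICube n → skel (n + 1)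
  /-- `Xⁿ` is the pushout of `Xⁿ⁻¹ ← ⨿ ∂Iⁿ ⊆ ⨿ Iⁿ`. -/
  isPushout : ∀ n, IsDiffPushout
    (fun p : (Σ _ : cell n, cubeBoundary n) => attach n p.1 p.2)
    (fun p : (Σ _ : cell n, cubeBoundary n) => (⟨p.1, p.2.1⟩ : Σ _ : cell n, ICube n))
    (Set.inclusion (skel_subset n))
    (fun p : (Σ _ : cell n, ICube n) => char n p.1 p.2)
  /-- `X` is the union of its skeleta ... -/
  iUnion_skel : ⋃ n, skel n = Set.univ
  /-- ... and, as a diffeological space, their colimit. -/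
  final : dX = ⨆ n, finalDiffeology (Subtype.val : skel n → X)

/-- Smooth CW complexes: the case `A = ∅`. -/
abbrev CWComplex (X : Type u) [DiffeologicalSpace X] := RelCWComplex X (∅ : Set X)

namespace RelCWComplex

variable {X : Type u} [DiffeologicalSpace X] {A : Set X}

/-- A smooth relative CW complex is gathered if all its attaching maps are tame. -/
def IsGathered (K : RelCWComplex X A) : Prop :=
  ∀ n (e : K.cell n), IsTame (K.attach n e)

/-- `dim < n`, i.e. `X` equals its `(n - 1)`-skeleton. -/
def DimLT (K : RelCWComplex X A) (n : ℕ) : Prop := K.skel n = Set.univ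

/-- `dim ≤ n`, i.e. `X` equals its `n`-skeleton. -/
def DimLE (K : RelCWComplex X A) (n : ℕ) : Prop := K.DimLT (n + 1)

end RelCWComplex

/-- The subspace `C` of a smooth CW complex `X` is a subcomplex: it is a smooth CW complex all of
whose characteristic maps are characteristic maps of `X`. -/
def CWComplex.IsSubcomplex {X : Type u} [DiffeologicalSpace X] (K : CWComplex X) (C : Set X) :
    Prop :=
  ∃ L : CWComplex C, ∀ n (e : L.cell n), ∃ e' : K.cell n, ∀ t : ICube n,
    ((L.char n e t : C) : X) = (K.char n e' t : X)

/-! ### Maps of pairs and their homotopy classes -/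

/-- Smooth maps of pairs `(X, A) → (Y, B)`. -/
structure PairMap {X : Type u} {Y : Type v} [DiffeologicalSpace X] [DiffeologicalSpace Y]
    (A : Set X) (B : Set Y) where
  toFun : X → Y
  smooth : DSmooth toFun
  mapsTo : Set.MapsTo toFun A B

namespace PairMap

variable {X : Type u} {Y : Type v} {Z : Type w}
  [DiffeologicalSpace X] [DiffeologicalSpace Y] [DiffeologicalSpace Z]
  {A : Set X} {B : Set Y} {C : Set Z}

/-- Composition of smooth maps of pairs. -/
def comp (g : PairMap B C) (f : PairMap A B) : PairMap A C where
  toFun := g.toFun ∘ f.toFun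
  smooth := g.smooth.comp f.smooth
  mapsTo := g.mapsTo.comp f.mapsTo

/-- Two smooth maps of pairs are homotopic if there is a smooth homotopy of pairs
`X × I → Y` between them. -/
def Homotopic (f g : PairMap A B) : Prop :=
  ∃ H : X × unitInterval → Y, DSmooth H ∧ (∀ x, H (x, 0) = f.toFun x) ∧
    (∀ x, H (x, 1) = g.toFun x) ∧ ∀ a ∈ A, ∀ t, H (a, t) ∈ B

end PairMap

section Equivalence

variable {X : Type u} {Y : Type v} [DiffeologicalSpace X] [DiffeologicalSpace Y]

theorem dSmooth_fst : DSmooth (Prod.fst : X × Y → X) := fun _ _ hp => hp.1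

theorem dSmooth_snd : DSmooth (Prod.snd : X × Y → Y) := fun _ _ hp => hp.2

theorem dSmooth_prodMk {W : Type w} [DiffeologicalSpace W] {f : W → X} {g : W → Y}
    (hf : DSmooth f) (hg : DSmooth g) : DSmooth (fun x => (f x, g x)) :=
  fun n p hp => ⟨hf n p hp, hg n p hp⟩

theorem dSmooth_val {P : X → Prop} : DSmooth (Subtype.val : {x // P x} → X) :=
  fun _ _ hp => hp

theorem dSmooth_subtype {P : Y → Prop} {f : X → {y // P y}}
    (hf : DSmooth (fun x => (f x : Y))) : DSmooth f :=
  fun n p hp => hf n p hp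

theorem dSmooth_intervalMap {f : unitInterval → unitInterval} {g : ℝ → ℝ}
    (hg : ContDiff ℝ (⊤ : ℕ∞) g) (h : ∀ t, (f t : ℝ) = g t) : DSmooth f := by
  refine dSmooth_subtype ?_
  have : (fun t => (f t : ℝ)) = g ∘ (Subtype.val : unitInterval → ℝ) := funext h
  rw [this]
  exact (ContDiff.dSmooth hg).comp dSmooth_val

/-- The reparametrization `t ↦ S (3 t - c)` of the unit interval, for a smooth step `S`. -/
def stepMap (c : ℝ) (t : unitInterval) : unitInterval :=
  ⟨Real.smoothTransition (3 * t - c), Real.smoothTransition.nonneg _,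
    Real.smoothTransition.le_one _⟩

theorem dSmooth_stepMap (c : ℝ) : DSmooth (stepMap c) := by
  refine dSmooth_intervalMap (g := fun s => Real.smoothTransition (3 * s - c)) ?_ fun t => rfl
  exact Real.smoothTransition.contDiff.comp ((contDiff_const.mul contDiff_id).sub contDiff_const)

theorem stepMap_eq_zero {c : ℝ} {t : unitInterval} (h : 3 * (t : ℝ) ≤ c) : stepMap c t = 0 :=
  Subtype.ext (Real.smoothTransition.zero_of_nonpos (by linarith))

theorem stepMap_eq_one {c : ℝ} {t : unitInterval} (h : 1 + c ≤ 3 * (t : ℝ)) : stepMap c t = 1 :=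
  Subtype.ext (Real.smoothTransition.one_of_one_le (by linarith))

end Equivalence

section Concat

variable {X : Type u} {Y : Type v}

open Classical in
/-- Concatenation of homotopies, slowed down around the middle. -/
def concat (F G : X × unitInterval → Y) (q : X × unitInterval) : Y :=
  if (q.2 : ℝ) ≤ 1 / 2 then F (q.1, stepMap 0 q.2) else G (q.1, stepMap 2 q.2)

theorem concat_eq_left {F G : X × unitInterval → Y} (h : ∀ x, F (x, 1) = G (x, 0))
    (q : X × unitInterval) (hq : (q.2 : ℝ) < 2 / 3) :
    concat F G q = F (q.1, stepMap 0 q.2) := by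
  unfold concat
  split_ifs with h'
  · rfl
  · rw [stepMap_eq_zero (by linarith), stepMap_eq_one (by linarith), h]

theorem concat_eq_right {F G : X × unitInterval → Y} (h : ∀ x, F (x, 1) = G (x, 0))
    (q : X × unitInterval) (hq : 1 / 3 < (q.2 : ℝ)) :
    concat F G q = G (q.1, stepMap 2 q.2) := by
  unfold concat
  split_ifs with h'
  · rw [stepMap_eq_one (by linarith), stepMap_eq_zero (by linarith), h]
  · rfl

end Concat

section Equivalence

variable {X : Type u} {Y : Type v} [DiffeologicalSpace X] [DiffeologicalSpace Y]

theorem dSmooth_concat {F G : X × unitInterval → Y} (hF : DSmooth F) (hG : DSmooth G)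
    (h : ∀ x, F (x, 1) = G (x, 0)) : DSmooth (concat F G) := by
  intro n p hp
  have hc : Continuous (fun r => ((p r).2 : ℝ)) :=
    (IsPlot.contDiff (X := ℝ) (p := fun r => ((p r).2 : ℝ)) hp.2).continuous
  have hF' : DSmooth (fun q : X × unitInterval => F (q.1, stepMap 0 q.2)) :=
    hF.comp (dSmooth_prodMk dSmooth_fst ((dSmooth_stepMap 0).comp dSmooth_snd))
  have hG' : DSmooth (fun q : X × unitInterval => G (q.1, stepMap 2 q.2)) :=
    hG.comp (dSmooth_prodMk dSmooth_fst ((dSmooth_stepMap 2).comp dSmooth_snd))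
  refine DiffeologicalSpace.locality fun r => ?_
  by_cases hr : ((p r).2 : ℝ) < 2 / 3
  · refine ⟨{r | ((p r).2 : ℝ) < 2 / 3}, isOpen_lt hc continuous_const, hr, ?_⟩
    intro m g hg hg'
    have : (concat F G ∘ p) ∘ g = (fun q => F (q.1, stepMap 0 q.2)) ∘ (p ∘ g) :=
      funext fun s => concat_eq_left h _ (hg s)
    rw [this]
    exact hF' m _ (isPlot_reparam hp hg')
  · refine ⟨{r | 1 / 3 < ((p r).2 : ℝ)}, isOpen_lt continuous_const hc, ?_, ?_⟩
    · show (1 / 3 : ℝ) < ((p r).2 : ℝ)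
      linarith
    · intro m g hg hg'
      have : (concat F G ∘ p) ∘ g = (fun q => G (q.1, stepMap 2 q.2)) ∘ (p ∘ g) :=
        funext fun s => concat_eq_right h _ (hg s)
      rw [this]
      exact hG' m _ (isPlot_reparam hp hg')

theorem homotopic_equivalence (A : Set X) (B : Set Y) :
    Equivalence (PairMap.Homotopic (A := A) (B := B)) where
  refl f := ⟨fun q => f.toFun q.1, f.smooth.comp dSmooth_fst, fun _ => rfl, fun _ => rfl,
    fun _ ha _ => f.mapsTo ha⟩
  symm := by
    rintro f g ⟨H, hH, h0, h1, hA⟩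
    have hs : DSmooth unitInterval.symm :=
      dSmooth_intervalMap (g := fun s => 1 - s) (contDiff_const.sub contDiff_id) fun t => rfl
    refine ⟨fun q => H (q.1, unitInterval.symm q.2),
      hH.comp (dSmooth_prodMk dSmooth_fst (hs.comp dSmooth_snd)), fun x => ?_, fun x => ?_,
      fun a ha t => hA a ha _⟩
    · simpa using h1 x
    · simpa using h0 x
  trans := by
    rintro f g k ⟨F, hF, hF0, hF1, hFA⟩ ⟨G, hG, hG0, hG1, hGA⟩
    have h : ∀ x, F (x, 1) = G (x, 0) := fun x => (hF1 x).trans (hG0 x).symm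
    refine ⟨concat F G, dSmooth_concat hF hG h, fun x => ?_, fun x => ?_, fun a ha t => ?_⟩
    · rw [concat_eq_left h _ (by norm_num), stepMap_eq_zero (by norm_num), hF0]
    · rw [concat_eq_right h _ (by norm_num), stepMap_eq_one (by norm_num), hG1]
    · unfold concat
      split_ifs
      · exact hFA a ha _
      · exact hGA a ha _

end Equivalence

section Classes

variable {X : Type u} {Y : Type v} {Z : Type w}
  [DiffeologicalSpace X] [DiffeologicalSpace Y] [DiffeologicalSpace Z]

/-- Homotopy of smooth maps of pairs, as a setoid. -/
def homotopySetoid (A : Set X) (B : Set Y) : Setoid (PairMap A B) :=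
  ⟨PairMap.Homotopic, homotopic_equivalence A B⟩

/-- `[X, A; Y, B]`, the set of homotopy classes of smooth maps of pairs `(X, A) → (Y, B)`. -/
def HomotopyClasses (A : Set X) (B : Set Y) : Type (max u v) :=
  Quotient (homotopySetoid A B)

/-- The map `φ_* : [Z, C; X, A] → [Z, C; Y, B]`, `[f] ↦ [φ ∘ f]`, induced by a smooth map of
pairs `φ : (X, A) → (Y, B)`. -/
def inducedMap (C : Set Z) {A : Set X} {B : Set Y} (φ : PairMap A B) :
    HomotopyClasses C A → HomotopyClasses C B :=
  Quotient.map' φ.comp (by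
    rintro f g ⟨H, hH, h0, h1, hC⟩
    exact ⟨φ.toFun ∘ H, φ.smooth.comp hH, fun x => congrArg φ.toFun (h0 x),
      fun x => congrArg φ.toFun (h1 x), fun c hc t => φ.mapsTo (hC c hc t)⟩)

/-! ### Homotopy groups and `N`-equivalences -/

/-- `π_n(X, x) = [Iⁿ, ∂Iⁿ; X, x]`. -/
abbrev HomotopyGroup (n : ℕ) (X : Type u) [DiffeologicalSpace X] (x : X) : Type u :=
  HomotopyClasses (cubeBoundary n) ({x} : Set X)

/-- The map `φ_* : π_n(X, x) → π_n(Y, φ x)` induced by a smooth map `φ : X → Y`. -/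
def homotopyGroupMap (n : ℕ) (φ : X → Y) (hφ : DSmooth φ) (x : X) :
    HomotopyGroup n X x → HomotopyGroup n Y (φ x) :=
  inducedMap (cubeBoundary n)
    (⟨φ, hφ, fun _ ha => congrArg φ ha⟩ : PairMap ({x} : Set X) ({φ x} : Set Y))

/-- A smooth map `φ : X → Y` is an `N`-equivalence if `φ_* : π_n(X, x) → π_n(Y, φ x)` is injective
for `n < N` and surjective for `n ≤ N`, for all `x`. Since surjectivity on path components cannot
be tested with base points in `X` when `X` is empty, `X` is required to be nonempty
if `Y` is. -/
structure IsNEquivalence (N : ℕ) (φ : X → Y) : Prop where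
  smooth : DSmooth φ
  nonempty : Nonempty Y → Nonempty X
  injective : ∀ (x : X) (n : ℕ), n < N → Function.Injective (homotopyGroupMap n φ smooth x)
  surjective : ∀ (x : X) (n : ℕ), n ≤ N → Function.Surjective (homotopyGroupMap n φ smooth x)

/-- A smooth map of pairs `φ : (X, A) → (Y, B)` is an `N`-equivalence if both `φ : X → Y` and its
restriction `A → B` are. -/
def PairMap.IsNEquivalence {A : Set X} {B : Set Y} (N : ℕ) (φ : PairMap A B) : Prop :=
  SmoothHomotopy.IsNEquivalence N φ.toFun ∧
    SmoothHomotopy.IsNEquivalence N (φ.mapsTo.restrict φ.toFun A B)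

end Classes

end SmoothHomotopy

end

open SmoothHomotopy

/-! Surjectivity is obstruction theory. For n ≤ N the hypotheses on homotopy groups say that a map f
on Iⁿ with a tame lift g of its boundary values through φ can be lifted up to homotopy relative to
∂Iⁿ (`HasCubeLifting`). If n = m + 1, a homotopy of the cube makes g constant on all faces but one
(`hasCubeLifting_succ`). Then f shows that φ kills the class of the remaining face, injectivity on
π_m contracts that face in X, and surjectivity on π_{m+1} lifts the sphere left over
(`solvable_of_eq_const`). Induction over skeleta (`exists_lift_skel`) lifts maps on (Z, C) up to
homotopy: cells of C use A → B, all others X → Y.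

Injectivity is surjectivity for another map. Let P be the space of triples (x₀, x₁, δ) with δ a path
from φ x₀ to φ x₁. A homotopy between φ ∘ f₀ and φ ∘ f₁ is a map Z → P, and lifting it up to
homotopy along the map from the path space of X to P yields a homotopy between f₀ and f₁
(`injective_inducedMap`). By adjunction, a lifting problem on Iⁿ for this map is one on Iⁿ⁺¹ for φ
(`HasCubeLifting.path`); the lost dimension accounts for dim < N.

Maps given piecewise are smooth when the formulas agree on overlapping open sets. The overlaps come
from `flatCube`, which sends a neighbourhood of the boundary into the boundary and is homotopic to
the identity without changing tame boundary values; the room gained serves as a collar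
(`collarExt`). Homotopies on pushouts are treated as maps into path spaces, so that the universal
property of the pushout itself applies to them. -/

noncomputable section

namespace SmoothHomotopy

universe u v

/-! ### Smooth maps between diffeological spaces -/

attribute [fun_prop] dSmooth_fst dSmooth_snd dSmooth_prodMk dSmooth_val dSmooth_subtype

section Smooth

variable {W : Type*} {T : Type*} [DiffeologicalSpace W] [DiffeologicalSpace T]

@[fun_prop]
theorem dSmooth_subtypeMk {P : T → Prop} {f : W → T} (hf : DSmooth f) (h : ∀ w, P (f w)) :
    DSmooth (fun w => (⟨f w, h w⟩ : {y // P y})) :=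
  dSmooth_subtype hf

theorem ContDiff.comp_dSmooth {g : ℝ → ℝ} (hg : ContDiff ℝ (⊤ : ℕ∞) g) {f : W → ℝ}
    (hf : DSmooth f) : DSmooth (fun w => g (f w)) :=
  (ContDiff.dSmooth hg).comp hf

@[fun_prop]
theorem dSmooth_add {f g : W → ℝ} (hf : DSmooth f) (hg : DSmooth g) :
    DSmooth (fun w => f w + g w) :=
  fun n p hp => ((hf n p hp).contDiff.add (hg n p hp).contDiff).isPlot

@[fun_prop]
theorem dSmooth_mul {f g : W → ℝ} (hf : DSmooth f) (hg : DSmooth g) :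
    DSmooth (fun w => f w * g w) :=
  fun n p hp => ((hf n p hp).contDiff.mul (hg n p hp).contDiff).isPlot

@[fun_prop]
theorem dSmooth_sub {f g : W → ℝ} (hf : DSmooth f) (hg : DSmooth g) :
    DSmooth (fun w => f w - g w) :=
  fun n p hp => ((hf n p hp).contDiff.sub (hg n p hp).contDiff).isPlot

@[fun_prop]
theorem dSmooth_div_const {f : W → ℝ} (hf : DSmooth f) (c : ℝ) :
    DSmooth (fun w => f w / c) :=
  ContDiff.comp_dSmooth (g := fun x => x / c) (contDiff_id.div_const c) hf

@[fun_prop]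
theorem dSmooth_prod {ι : Type*} (s : Finset ι) {f : ι → W → ℝ} (hf : ∀ i, DSmooth (f i)) :
    DSmooth (fun w => ∏ i ∈ s, f i w) :=
  fun n p hp => (contDiff_prod (t := s) (f := fun i => f i ∘ p)
    fun i _ => (hf i n p hp).contDiff).isPlot

@[fun_prop]
theorem dSmooth_smoothTransition {f : W → ℝ} (hf : DSmooth f) :
    DSmooth (fun w => Real.smoothTransition (f w)) :=
  ContDiff.comp_dSmooth Real.smoothTransition.contDiff hf

theorem dSmooth_euclidean {n : ℕ} {f : W → EuclideanSpace ℝ (Fin n)}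
    (hf : ∀ i, DSmooth (fun w => f w i)) : DSmooth f :=
  fun m p hp => (contDiff_euclidean.2 fun i => (hf i m p hp).contDiff).isPlot

/-- Smoothness is local with respect to the sets where a smooth function is positive. -/
theorem dSmooth_of_locally {f : W → T}
    (h : ∀ w, ∃ a : W → ℝ, DSmooth a ∧ 0 < a w ∧ DSmooth (fun x : {x // 0 < a x} => f x)) :
    DSmooth f := by
  intro n p hp
  refine DiffeologicalSpace.locality fun r => ?_
  obtain ⟨a, ha, har, haf⟩ := h (p r)
  have hc : Continuous (fun r => a (p r)) := (ha n p hp).contDiff.continuous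
  refine ⟨{r | 0 < a (p r)}, isOpen_lt continuous_const hc, har, fun {m g} hg hg' => ?_⟩
  exact haf m (fun r => ⟨p (g r), hg r⟩) (isPlot_reparam hp hg')

end Smooth

/-! ### Universal properties -/

section Final

variable {X₁ : Type*} {X₂ : Type*} {W : Type*} {T : Type*} [DiffeologicalSpace X₁]
  [DiffeologicalSpace X₂] [DiffeologicalSpace T]

/-- It suffices to test the generating plots. With smoothness of `g` written as an inequality,
coproducts and pushouts reduce to bounding suprema. -/
theorem finalDiffeology_le_induced {f : X₁ → W} {g : W → T} (h : DSmooth (g ∘ f)) :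
    finalDiffeology f ≤ inducedDiffeology g := by
  refine DiffeologicalSpace.generateFrom_le_iff.2 ?_
  rintro n q ⟨p, hp, hq⟩
  have e : g ∘ q = (g ∘ f) ∘ p := congrArg (g ∘ ·) hq
  change IsPlot (g ∘ q)
  rw [e]
  exact h n p hp

theorem dSmooth_of_le_induced {dW : DiffeologicalSpace W} {g : W → T}
    (h : dW ≤ inducedDiffeology g) : DSmooth g :=
  fun n _ hp => DiffeologicalSpace.le_iff.1 h n hp

theorem dSmooth_sigma {ι : Type u} {S : ι → Type v} [∀ i, DiffeologicalSpace (S i)]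
    {g : (Σ i, S i) → T} (h : ∀ i, DSmooth (fun x : S i => g ⟨i, x⟩)) : DSmooth g :=
  dSmooth_of_le_induced (iSup_le fun i => finalDiffeology_le_induced (h i))

theorem dSmooth_finalMap (f : X₁ → W) : @DSmooth _ _ _ (finalDiffeology f) f :=
  fun _ p hp => DiffeologicalSpace.isPlot_generatedFrom_of_mem ⟨p, hp, rfl⟩

theorem dSmooth_sigmaMk {ι : Type u} {S : ι → Type v} [∀ i, DiffeologicalSpace (S i)] (i : ι) :
    DSmooth (fun x : S i => (⟨i, x⟩ : Σ i, S i)) :=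
  fun n p hp => DiffeologicalSpace.le_iff.1
    (le_iSup (fun i => finalDiffeology (fun x : S i => (⟨i, x⟩ : Σ i, S i))) i) n
    (dSmooth_finalMap _ n p hp)

variable {S : Type*} [DiffeologicalSpace S] [DiffeologicalSpace W]
  {i₁ : S → X₁} {i₂ : S → X₂} {f₁ : X₁ → W} {f₂ : X₂ → W}

/-- The given maps are constant on the classes of the generated equivalence relation, so arbitrary
preimages define `g`; finality of the diffeology makes it smooth. -/
theorem IsDiffPushout.exists_desc (h : IsDiffPushout i₁ i₂ f₁ f₂) {u₁ : X₁ → T} {u₂ : X₂ → T}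
    (hu₁ : DSmooth u₁) (hu₂ : DSmooth u₂) (hu : ∀ a, u₁ (i₁ a) = u₂ (i₂ a)) :
    ∃ g : W → T, DSmooth g ∧ (∀ x, g (f₁ x) = u₁ x) ∧ ∀ x, g (f₂ x) = u₂ x := by
  have e : ∀ p q, Relation.EqvGen (GlueRel i₁ i₂) p q →
      Sum.elim u₁ u₂ p = Sum.elim u₁ u₂ q := by
    intro p q hpq
    induction hpq with
    | rel p q h => obtain ⟨a, rfl, rfl⟩ := h; exact hu a
    | refl => rfl
    | symm _ _ _ ih => exact ih.symm
    | trans _ _ _ _ _ ih₁ ih₂ => exact ih₁.trans ih₂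
  have h₁ : ∀ p, Sum.elim u₁ u₂ (Function.surjInv h.surjective (Sum.elim f₁ f₂ p)) =
      Sum.elim u₁ u₂ p := fun p => e _ _ (h.ker _ _ (Function.surjInv_eq _ _))
  refine ⟨fun w => Sum.elim u₁ u₂ (Function.surjInv h.surjective w), ?_,
    fun x => h₁ (Sum.inl x), fun x => h₁ (Sum.inr x)⟩
  refine dSmooth_of_le_induced ?_
  refine h.final.le.trans (sup_le (finalDiffeology_le_induced ?_) (finalDiffeology_le_induced ?_))
  · convert hu₁ using 1
    exact funext fun x => h₁ (Sum.inl x)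
  · convert hu₂ using 1
    exact funext fun x => h₁ (Sum.inr x)

/-- Points outside the glued part are only identified with themselves. -/
theorem IsDiffPushout.eq_of_inr (h : IsDiffPushout i₁ i₂ f₁ f₂) {x : X₂}
    (hx : ∀ a, i₂ a ≠ x) {p : X₁ ⊕ X₂} (hp : Sum.elim f₁ f₂ p = f₂ x) : p = Sum.inr x := by
  have e : ∀ p q, Relation.EqvGen (GlueRel i₁ i₂) p q → (p = Sum.inr x ↔ q = Sum.inr x) := by
    intro p q hpq
    induction hpq with
    | rel p q h =>
      obtain ⟨a, rfl, rfl⟩ := h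
      simpa using hx a
    | refl => rfl
    | symm _ _ _ ih => exact ih.symm
    | trans _ _ _ _ _ ih₁ ih₂ => exact ih₁.trans ih₂
  exact (e _ _ (h.ker p (Sum.inr x) hp)).2 rfl

end Final

/-! ### Spaces of smooth paths -/

/-- Smooth paths `I → X`. -/
@[ext]
structure SPath (X : Type*) [DiffeologicalSpace X] where
  toFun : unitInterval → X
  smooth : DSmooth toFun

/-- Path spaces carry the functional diffeology. -/
instance SPath.instDiffeologicalSpace {X : Type*} [DiffeologicalSpace X] :
    DiffeologicalSpace (SPath X) where
  plots n := {p : EuclideanSpace ℝ (Fin n) → SPath X |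
    DSmooth (fun q : EuclideanSpace ℝ (Fin n) × unitInterval => (p q.1).toFun q.2)}
  constant_plots x := x.smooth.comp dSmooth_snd
  plot_reparam {n m p g} hp hg := by
    have hg' : DSmooth g := hg.dSmooth
    exact hp.comp (dSmooth_prodMk (hg'.comp dSmooth_fst) dSmooth_snd)
  locality {n p} hp := by
    intro k q hq
    refine DiffeologicalSpace.locality fun r => ?_
    obtain ⟨s, hs, hx, h⟩ := hp (q r).1
    have hc : ContDiff ℝ (⊤ : ℕ∞) (fun r => (q r).1) :=
      IsPlot.contDiff (p := fun r => (q r).1) hq.1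
    refine ⟨(fun r => (q r).1) ⁻¹' s, hs.preimage hc.continuous, hx, fun {m g} hg hg' => ?_⟩
    -- The first component of `q ∘ g` reparametrizes `p` within `s`; the resulting plot of paths is
    -- evaluated along the graph of the second component.
    exact h (f := fun x => (q (g x)).1) hg (hc.comp hg') m (fun x => (x, (q (g x)).2))
      ⟨isPlot_id, isPlot_reparam hq.2 hg'⟩

section Path

variable {W : Type*} {X : Type*} [DiffeologicalSpace W] [DiffeologicalSpace X]

/-- Currying of smooth maps. -/
def curryPath (H : W × unitInterval → X) (hH : DSmooth H) (w : W) : SPath X where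
  toFun s := H (w, s)
  smooth := hH.comp (dSmooth_prodMk dSmooth_const dSmooth_id)

theorem dSmooth_curryPath {H : W × unitInterval → X} (hH : DSmooth H) :
    DSmooth (curryPath H hH) := by
  intro n p hp
  have hp' : DSmooth p := hp.dSmooth
  exact hH.comp (dSmooth_prodMk (hp'.comp dSmooth_fst) dSmooth_snd)

@[fun_prop]
theorem dSmooth_toFun {f : W → SPath X} {g : W → unitInterval} (hf : DSmooth f) (hg : DSmooth g) :
    DSmooth (fun w => (f w).toFun (g w)) :=
  fun n p hp => hf n p hp n (fun r => (r, g (p r))) ⟨isPlot_id, hg n p hp⟩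

theorem dSmooth_path {f : W → SPath X}
    (hf : DSmooth (fun q : W × unitInterval => (f q.1).toFun q.2)) : DSmooth f :=
  dSmooth_curryPath hf

end Path

/-! ### The unit interval -/

section Interval

variable {W : Type*} [DiffeologicalSpace W]

/-- The point `(1 - s) a + s b` of the unit interval. -/
def lerp (s a b : unitInterval) : unitInterval :=
  ⟨(1 - s) * a + s * b, by
    obtain ⟨s, hs₀, hs₁⟩ := s
    obtain ⟨a, ha₀, ha₁⟩ := a
    obtain ⟨b, hb₀, hb₁⟩ := b
    constructor <;> simp only <;> nlinarith⟩

@[simp] theorem lerp_zero (a b : unitInterval) : lerp 0 a b = a := Subtype.ext (by simp [lerp])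

@[simp] theorem lerp_one (a b : unitInterval) : lerp 1 a b = b := Subtype.ext (by simp [lerp])

@[simp] theorem lerp_self (s a : unitInterval) : lerp s a a = a :=
  Subtype.ext (by simp only [lerp]; ring)

@[fun_prop]
theorem dSmooth_lerp {s a b : W → unitInterval} (hs : DSmooth s) (ha : DSmooth a)
    (hb : DSmooth b) : DSmooth (fun w => lerp (s w) (a w) (b w)) := by
  unfold lerp
  fun_prop

@[fun_prop]
theorem dSmooth_mulI {a b : W → unitInterval} (ha : DSmooth a)
    (hb : DSmooth b) : DSmooth (fun w => a w * b w) := by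
  have : DSmooth (fun w => (a w : ℝ) * (b w : ℝ)) := by fun_prop
  exact dSmooth_subtype this

@[fun_prop]
theorem dSmooth_symmI {a : W → unitInterval} (ha : DSmooth a) :
    DSmooth (fun w => unitInterval.symm (a w)) := by
  have : DSmooth (fun w => (1 : ℝ) - (a w : ℝ)) := by fun_prop
  exact dSmooth_subtype this

/-- The smooth step function with values in the unit interval. -/
def stepI (x : ℝ) : unitInterval :=
  ⟨Real.smoothTransition x, Real.smoothTransition.nonneg _, Real.smoothTransition.le_one _⟩

@[fun_prop]
theorem dSmooth_stepI {f : W → ℝ} (hf : DSmooth f) : DSmooth (fun w => stepI (f w)) := by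
  unfold stepI
  fun_prop

theorem stepI_eq_zero {x : ℝ} (h : x ≤ 0) : stepI x = 0 :=
  Subtype.ext (Real.smoothTransition.zero_of_nonpos h)

theorem stepI_eq_one {x : ℝ} (h : 1 ≤ x) : stepI x = 1 :=
  Subtype.ext (Real.smoothTransition.one_of_one_le h)

/-- A smooth map `I → I` which is constant near the ends, and the identity away from them. -/
def flat (ε : ℝ) (x : unitInterval) : unitInterval :=
  lerp (stepI (2 * (1 - x) / ε - 1)) 1 (x * stepI (2 * x / ε - 1))

@[fun_prop]
theorem dSmooth_flat (ε : ℝ) {a : W → unitInterval} (ha : DSmooth a) :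
    DSmooth (fun w => flat ε (a w)) := by
  unfold flat
  fun_prop

open Classical in
/-- The points at distance at most `ε` from an end of the interval are moved to that end. -/
def snap (ε : ℝ) (x : unitInterval) : unitInterval :=
  if (x : ℝ) ≤ ε then 0 else if 1 - ε ≤ (x : ℝ) then 1 else x

variable {ε : ℝ}

theorem flat_eq_zero (hε : 0 < ε) (hε' : ε ≤ 1 / 4) {x : unitInterval} (hx : (x : ℝ) ≤ ε / 2) :
    flat ε x = 0 := by
  unfold flat
  rw [stepI_eq_one, stepI_eq_zero]
  · simp
  · rw [sub_nonpos, div_le_one hε]; linarith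
  · rw [le_sub_iff_add_le, le_div_iff₀ hε]; linarith

theorem flat_eq_one (hε : 0 < ε) {x : unitInterval}
    (hx : 1 - ε / 2 ≤ (x : ℝ)) : flat ε x = 1 := by
  unfold flat
  rw [stepI_eq_zero]
  · simp
  · rw [sub_nonpos, div_le_one hε]; linarith

theorem flat_of_le (hε : 0 < ε) {x : unitInterval} (hx : (x : ℝ) ≤ 1 - ε) :
    flat ε x = x * stepI (2 * x / ε - 1) := by
  unfold flat
  rw [stepI_eq_one, lerp_one]
  rw [le_sub_iff_add_le, le_div_iff₀ hε]; linarith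

theorem flat_of_ge (hε : 0 < ε) {x : unitInterval} (hx : ε ≤ (x : ℝ)) :
    flat ε x = lerp (stepI (2 * (1 - x) / ε - 1)) 1 x := by
  unfold flat
  rw [stepI_eq_one (x := 2 * x / ε - 1), mul_one]
  rw [le_sub_iff_add_le, le_div_iff₀ hε]; linarith

theorem flat_eq_self (hε : 0 < ε) {x : unitInterval} (hx : ε ≤ (x : ℝ))
    (hx' : (x : ℝ) ≤ 1 - ε) : flat ε x = x := by
  rw [flat_of_le hε hx', stepI_eq_one, mul_one]
  rw [le_sub_iff_add_le, le_div_iff₀ hε]; linarith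

theorem flat_zero (hε : 0 < ε) (hε' : ε ≤ 1 / 4) : flat ε 0 = 0 :=
  flat_eq_zero hε hε' (by simp; positivity)

theorem flat_one (hε : 0 < ε) : flat ε 1 = 1 :=
  flat_eq_one hε (by simp; positivity)

theorem snap_zero (hε : 0 < ε) : snap ε 0 = 0 := by simp [snap, hε.le]

theorem snap_one (hε : 0 < ε) (hε' : ε ≤ 1 / 4) : snap ε 1 = 1 := by
  unfold snap
  rw [if_neg, if_pos] <;> simp <;> linarith

/-- `flat ε` moves points of [0, ε] towards 0 and points of [1 - ε, 1] towards 1, and fixes the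
others. Hence tame maps do not notice the linear homotopy to it. -/
theorem snap_lerp_flat (hε : 0 < ε) (hε' : ε ≤ 1 / 4) (s x : unitInterval) :
    snap ε (lerp s x (flat ε x)) = snap ε x := by
  by_cases h₁ : (x : ℝ) ≤ ε
  · have h₂ : (flat ε x : ℝ) ≤ ε := by
      rw [flat_of_le hε (by linarith)]
      refine le_trans ?_ h₁
      exact mul_le_of_le_one_right x.2.1 (stepI _).2.2
    have h₃ : (lerp s x (flat ε x) : ℝ) ≤ ε := by
      have h₀ := s.2.1
      have h₁ := s.2.2
      simp only [lerp]
      nlinarith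
    rw [snap, snap, if_pos h₁, if_pos h₃]
  by_cases h₂ : 1 - ε ≤ (x : ℝ)
  · have h₃ : (x : ℝ) ≤ flat ε x := by
      rw [flat_of_ge hε (by linarith)]
      have h₀ := (stepI (2 * (1 - x) / ε - 1)).2.1
      have h₁ := (stepI (2 * (1 - x) / ε - 1)).2.2
      have h₂ := x.2.2
      simp only [lerp, Set.Icc.coe_one]
      nlinarith
    have h₄ : 1 - ε ≤ (lerp s x (flat ε x) : ℝ) := by
      have h₀ := s.2.1
      have h₁ := s.2.2
      simp only [lerp]
      nlinarith
    rw [snap, snap, if_neg h₁, if_pos h₂, if_neg (by linarith), if_pos h₄]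
  · rw [flat_eq_self hε (by linarith) (by linarith), lerp_self]

theorem snap_flat (hε : 0 < ε) (hε' : ε ≤ 1 / 4) (x : unitInterval) :
    snap ε (flat ε x) = snap ε x := by
  simpa using snap_lerp_flat hε hε' 1 x

/-- A smooth function on `I` which equals `1` at the ends and vanishes unless `flat ε` maps `x`
to an end. -/
def bump (ε : ℝ) (x : unitInterval) : ℝ :=
  stepI (1 - (x : ℝ) * (1 - x) / (ε / 4))

@[fun_prop]
theorem dSmooth_bump (ε : ℝ) {a : W → unitInterval} (ha : DSmooth a) :
    DSmooth (fun w => bump ε (a w)) := by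
  unfold bump
  fun_prop

@[simp] theorem bump_zero : bump ε 0 = 1 := by simp [bump, stepI_eq_one]

@[simp] theorem bump_one : bump ε 1 = 1 := by simp [bump, stepI_eq_one]

/-- A nonzero value means x(1 - x) < ε/4. One factor is at least 1/2, so the other is below ε/2,
where `flat ε` is constant. -/
theorem flat_of_bump_ne_zero (hε : 0 < ε) (hε' : ε ≤ 1 / 4) {x : unitInterval}
    (h : bump ε x ≠ 0) : flat ε x = 0 ∨ flat ε x = 1 := by
  have h₁ : (x : ℝ) * (1 - x) < ε / 4 := by
    by_contra! h'
    refine h ?_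
    rw [bump, stepI_eq_zero]
    · rfl
    · rw [sub_nonpos, le_div_iff₀ (by positivity)]; linarith
  obtain ⟨h₂, h₃⟩ := x.2
  by_cases h₄ : (x : ℝ) ≤ 1 / 2
  · left
    apply flat_eq_zero hε hε'
    nlinarith
  · right
    apply flat_eq_one hε
    nlinarith

end Interval

/-! ### Cubes -/

section Cube

variable {W : Type*} [DiffeologicalSpace W] {n : ℕ}

/-- The coordinates of a point of the cube. -/
def coord (t : ICube n) (i : Fin n) : unitInterval := ⟨t.1 i, t.2 i⟩

/-- The point of the cube with given coordinates. -/
def cubeMk (x : Fin n → unitInterval) : ICube n :=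
  ⟨WithLp.toLp 2 fun i => (x i : ℝ), fun i => (x i).2⟩

@[simp] theorem coord_cubeMk (x : Fin n → unitInterval) (i : Fin n) : coord (cubeMk x) i = x i :=
  rfl

@[simp] theorem cubeMk_coord (t : ICube n) : cubeMk (coord t) = t := rfl

theorem cube_ext {s t : ICube n} (h : ∀ i, coord s i = coord t i) : s = t := by
  rw [← cubeMk_coord s, ← cubeMk_coord t, funext h]

@[fun_prop]
theorem dSmooth_coord {f : W → ICube n} (hf : DSmooth f) (i : Fin n) :
    DSmooth (fun w => coord (f w) i) := by
  have h : DSmooth (fun x : EuclideanSpace ℝ (Fin n) => x i) := by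
    apply ContDiff.dSmooth
    fun_prop
  exact dSmooth_subtype (h.comp (dSmooth_val.comp hf))

theorem dSmooth_cubeMk {f : W → Fin n → unitInterval} (hf : ∀ i, DSmooth (fun w => f w i)) :
    DSmooth (fun w => cubeMk (f w)) :=
  dSmooth_subtype (dSmooth_euclidean fun i => dSmooth_val.comp (hf i))

theorem mem_cubeBoundary {t : ICube n} :
    t ∈ cubeBoundary n ↔ ∃ i, coord t i = 0 ∨ coord t i = 1 := by
  simp only [cubeBoundary, Set.mem_ofPred_eq, coord, Subtype.ext_iff, Set.Icc.coe_zero,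
    Set.Icc.coe_one]

/-- The map of the cube given by `flat` in each coordinate. -/
def flatCube (ε : ℝ) (t : ICube n) : ICube n := cubeMk fun i => flat ε (coord t i)

@[fun_prop]
theorem dSmooth_flatCube (ε : ℝ) {f : W → ICube n} (hf : DSmooth f) :
    DSmooth (fun w => flatCube ε (f w)) :=
  dSmooth_cubeMk fun i => by fun_prop

/-- The linear homotopy from the identity to `flatCube`. -/
def flatHtpy (ε : ℝ) (t : ICube n) (s : unitInterval) : ICube n :=
  cubeMk fun i => lerp s (coord t i) (flat ε (coord t i))

@[fun_prop]
theorem dSmooth_flatHtpy (ε : ℝ) {f : W → ICube n} {g : W → unitInterval} (hf : DSmooth f)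
    (hg : DSmooth g) : DSmooth (fun w => flatHtpy ε (f w) (g w)) :=
  dSmooth_cubeMk fun i => by fun_prop

@[simp] theorem flatHtpy_zero (ε : ℝ) (t : ICube n) : flatHtpy ε t 0 = t := by simp [flatHtpy]

@[simp] theorem flatHtpy_one (ε : ℝ) (t : ICube n) : flatHtpy ε t 1 = flatCube ε t := by
  simp [flatHtpy, flatCube]

/-- A smooth function on the cube which equals `1` on the boundary and vanishes away from it. -/
def collar (ε : ℝ) (t : ICube n) : unitInterval :=
  stepI (1 - 2 * ∏ i, (1 - bump ε (coord t i)))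

@[fun_prop]
theorem dSmooth_collar (ε : ℝ) {f : W → ICube n} (hf : DSmooth f) :
    DSmooth (fun w => collar ε (f w)) := by
  unfold collar
  fun_prop

theorem collar_eq_one (ε : ℝ) {t : ICube n} (ht : t ∈ cubeBoundary n) : collar ε t = 1 := by
  obtain ⟨i, hi⟩ := mem_cubeBoundary.1 ht
  refine stepI_eq_one ?_
  rw [Finset.prod_eq_zero (Finset.mem_univ i)]
  · simp
  · rcases hi with hi | hi <;> simp [hi]

variable {ε : ℝ}

theorem flatCube_mem (hε : 0 < ε) (hε' : ε ≤ 1 / 4) {t : ICube n} (ht : t ∈ cubeBoundary n) :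
    flatCube ε t ∈ cubeBoundary n := by
  obtain ⟨i, hi⟩ := mem_cubeBoundary.1 ht
  refine mem_cubeBoundary.2 ⟨i, ?_⟩
  rcases hi with hi | hi <;> simp [flatCube, hi, flat_zero hε hε', flat_one hε]

theorem flatHtpy_mem (hε : 0 < ε) (hε' : ε ≤ 1 / 4) {t : ICube n} (ht : t ∈ cubeBoundary n)
    (s : unitInterval) : flatHtpy ε t s ∈ cubeBoundary n := by
  obtain ⟨i, hi⟩ := mem_cubeBoundary.1 ht
  refine mem_cubeBoundary.2 ⟨i, ?_⟩
  rcases hi with hi | hi <;> simp [flatHtpy, hi, flat_zero hε hε', flat_one hε]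

theorem flatCube_mem_of_prod_ne_one (hε : 0 < ε) (hε' : ε ≤ 1 / 4) {t : ICube n}
    (ht : ∏ i, (1 - bump ε (coord t i)) ≠ 1) : flatCube ε t ∈ cubeBoundary n := by
  by_contra h
  refine ht (Finset.prod_eq_one fun i _ => ?_)
  by_contra h'
  exact h (mem_cubeBoundary.2 ⟨i, flat_of_bump_ne_zero hε hε' fun h'' => h' (by simp [h''])⟩)

theorem flatCube_mem_of_collar_ne_zero (hε : 0 < ε) (hε' : ε ≤ 1 / 4) {t : ICube n}
    (ht : collar ε t ≠ 0) : flatCube ε t ∈ cubeBoundary n := by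
  refine flatCube_mem_of_prod_ne_one hε hε' fun h => ht (stepI_eq_zero ?_)
  rw [h]; norm_num

/-! ### Tame maps -/

section Tame

variable {X : Type*} {g : cubeBoundary n → X}

/-- Tameness changes one coordinate at a time, so the coordinates are snapped successively. Since 0
and 1 are fixed by `snap`, the intermediate points stay on the boundary. -/
theorem IsTameWith.eq_of_snap_eq (hg : IsTameWith ε g) (hε : 0 < ε) (hε' : ε ≤ 1 / 4)
    {s t : cubeBoundary n} (h : ∀ i, snap ε (coord s.1 i) = snap ε (coord t.1 i)) :
    g s = g t := by
  classical
  have mem : ∀ (s : cubeBoundary n) (F : Finset (Fin n)),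
      cubeMk (fun i => if i ∈ F then snap ε (coord s.1 i) else coord s.1 i) ∈ cubeBoundary n := by
    intro s F
    obtain ⟨i, hi⟩ := mem_cubeBoundary.1 s.2
    refine mem_cubeBoundary.2 ⟨i, ?_⟩
    rcases hi with hi | hi <;> simp [hi, snap_zero hε, snap_one hε hε']
  have key : ∀ (s : cubeBoundary n) (F : Finset (Fin n)), g s = g ⟨_, mem s F⟩ := by
    intro s F
    induction F using Finset.induction_on with
    | empty => simp
    | insert j F hj ih =>
      rw [ih]
      by_cases hs : snap ε (coord s.1 j) = coord s.1 j
      · congr 1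
        refine Subtype.ext (cube_ext fun i => ?_)
        simp only [coord_cubeMk, Finset.mem_insert]
        by_cases hi : i = j
        · subst hi; simp [hj, hs]
        · simp [hi]
      · refine hg _ _ j (fun i hi => ?_) ?_ ?_
        · simp [cubeMk, hi]
        · simp only [cubeMk, Finset.mem_insert_self, if_true, snap] at hs ⊢
          split_ifs with h₁ h₂
          · simp
          · simp
          · exact absurd (by rw [if_neg h₁, if_neg h₂]) hs
        · simp only [cubeMk, Finset.mem_insert_self, if_true, hj, if_false, snap] at hs ⊢
          have := (coord s.1 j).2
          split_ifs with h₁ h₂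
          · simpa [abs_of_nonneg this.1] using h₁
          · simp only [Set.Icc.coe_one]
            rw [abs_le]
            constructor <;> linarith [this.2]
          · exact absurd (by rw [if_neg h₁, if_neg h₂]) hs
  rw [key s Finset.univ, key t Finset.univ]
  congr 1
  exact Subtype.ext (cube_ext fun i => by simpa using h i)

theorem IsTameWith.flatHtpy_eq (hg : IsTameWith ε g) (hε : 0 < ε) (hε' : ε ≤ 1 / 4)
    (t : cubeBoundary n) (s : unitInterval) : g ⟨_, flatHtpy_mem hε hε' t.2 s⟩ = g t :=
  hg.eq_of_snap_eq hε hε' fun i => snap_lerp_flat hε hε' s (coord t.1 i)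

theorem IsTameWith.flatCube_eq (hg : IsTameWith ε g) (hε : 0 < ε) (hε' : ε ≤ 1 / 4)
    (t : cubeBoundary n) : g ⟨_, flatCube_mem hε hε' t.2⟩ = g t :=
  hg.eq_of_snap_eq hε hε' fun i => snap_flat hε hε' (coord t.1 i)

theorem IsTame.exists_le (hg : IsTame g) : ∃ ε : ℝ, 0 < ε ∧ ε ≤ 1 / 4 ∧ IsTameWith ε g := by
  obtain ⟨ε, h₀, -, h⟩ := hg
  exact ⟨min ε (1 / 4), by positivity, min_le_right _ _,
    fun s t j hi hj hst => h s t j hi hj (hst.trans (min_le_left _ _))⟩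

theorem IsTame.comp {Y : Type*} (hg : IsTame g) (k : X → Y) : IsTame (k ∘ g) := by
  obtain ⟨ε, h₀, h₁, h⟩ := hg
  exact ⟨ε, h₀, h₁, fun s t j hi hj hst => congrArg k (h s t j hi hj hst)⟩

/-- Source of tame boundary values: within ε/2 of an end `flat ε` is already constant. -/
theorem isTame_of_flatCube (hε : 0 < ε) (hε' : ε ≤ 1 / 4) (g : cubeBoundary n → X) :
    IsTame (fun t : cubeBoundary n => g ⟨_, flatCube_mem hε hε' t.2⟩) := by
  refine ⟨ε / 2, by positivity, by linarith, fun s t j hi hj hst => ?_⟩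
  have : flatCube ε s.1 = flatCube ε t.1 := ?_
  · simp only [this]
  refine cube_ext fun i => ?_
  simp only [flatCube, coord_cubeMk]
  by_cases hij : i = j
  · subst hij
    have h₁ : (coord s.1 i : ℝ) = s.1.1 i := rfl
    have h₂ := abs_le.1 hst
    rcases hj with hj | hj
    · have h₃ : coord t.1 i = 0 := Subtype.ext hj
      rw [h₃, flat_zero hε hε', flat_eq_zero hε hε']
      linarith
    · have h₃ : coord t.1 i = 1 := Subtype.ext hj
      rw [h₃, flat_one hε, flat_eq_one hε]
      linarith
  · congr 1
    exact Subtype.ext (hi i hij)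

end Tame

end Cube

/-! ### Extension over a collar -/

section Collar

variable {P : Type*} {T : Type*} {n : ℕ} {ε : ℝ}

open Classical in
/-- Given `F` on the cube and a homotopy `h` on its boundary starting at `F`, this is `F` on
an inner cube, while the homotopy runs through a collar of the boundary. -/
def collarExt (ε : ℝ) (F : ICube n × P → T) (h : cubeBoundary n × unitInterval × P → T)
    (q : ICube n × P) : T :=
  if hq : flatCube ε q.1 ∈ cubeBoundary n then h (⟨_, hq⟩, collar ε q.1, q.2)
  else F (flatCube ε q.1, q.2)

theorem collarExt_boundary (hε : 0 < ε) (hε' : ε ≤ 1 / 4) (F : ICube n × P → T)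
    (h : cubeBoundary n × unitInterval × P → T) (t : cubeBoundary n) (p : P) :
    collarExt ε F h (t.1, p) = h (⟨_, flatCube_mem hε hε' t.2⟩, 1, p) := by
  rw [collarExt, dif_pos (flatCube_mem hε hε' t.2)]
  rw [collar_eq_one ε t.2]

theorem collarExt_of_const {F : ICube n × P → T} {h : cubeBoundary n × unitInterval × P → T}
    {p : P} (hp : ∀ t s, h (t, s, p) = F (t.1, p)) (t : ICube n) :
    collarExt ε F h (t, p) = F (flatCube ε t, p) := by
  unfold collarExt
  split_ifs with ht
  · exact hp _ _
  · rfl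

/-- Where a < 1, `flatCube` lands in the boundary and the map is given by `h`. Where a > 1/2, the
collar parameter is 0 and `h₀` turns both cases into `F`. These two regions cover the cube. -/
theorem dSmooth_collarExt [DiffeologicalSpace P] [DiffeologicalSpace T] (hε : 0 < ε) (hε' : ε ≤ 1 / 4) {F : ICube n × P → T}
    {h : cubeBoundary n × unitInterval × P → T} (hF : DSmooth F) (hh : DSmooth h)
    (h₀ : ∀ t p, h (t, 0, p) = F (t.1, p)) : DSmooth (collarExt ε F h) := by
  refine dSmooth_of_locally fun q => ?_
  let a : ICube n × P → ℝ := fun q => ∏ i, (1 - bump ε (coord q.1 i))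
  have ha : DSmooth a := by fun_prop
  by_cases hq : a q < 1
  · refine ⟨fun q => 1 - a q, by fun_prop, by linarith, ?_⟩
    have hm : ∀ x : {x // 0 < 1 - a x}, flatCube ε x.1.1 ∈ cubeBoundary n := fun x =>
      flatCube_mem_of_prod_ne_one hε hε' (ne_of_lt (by have := x.2; simp only [a] at this; linarith))
    have e : (fun x : {x // 0 < 1 - a x} => collarExt ε F h x) =
        fun x => h (⟨_, hm x⟩, collar ε x.1.1, x.1.2) :=
      funext fun x => dif_pos (hm x)
    rw [e]
    fun_prop
  · refine ⟨fun q => a q - 1 / 2, by fun_prop, by linarith, ?_⟩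
    have e : (fun x : {x // 0 < a x - 1 / 2} => collarExt ε F h x) =
        fun x => F (flatCube ε x.1.1, x.1.2) := by
      funext x
      have hc : collar ε x.1.1 = 0 := stepI_eq_zero (by
        have := x.2; simp only [a] at this; linarith)
      unfold collarExt
      split_ifs with ht
      · rw [hc, h₀]
      · rfl
    rw [e]
    fun_prop

end Collar

/-! ### Homotopies relative to the boundary of the cube -/

section Concat

variable {Q : Type*} {Y : Type*} {F G : Q × unitInterval → Y}

theorem concat_zero (x : Q) : concat F G (x, 0) = F (x, 0) := by
  simp only [concat, Set.Icc.coe_zero]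
  rw [if_pos (by norm_num), stepMap_eq_zero (by norm_num)]

theorem concat_one (x : Q) : concat F G (x, 1) = G (x, 1) := by
  simp only [concat, Set.Icc.coe_one]
  rw [if_neg (by norm_num), stepMap_eq_one (by norm_num)]

theorem concat_of_const {x : Q} {y : Y} (hF : ∀ s, F (x, s) = y) (hG : ∀ s, G (x, s) = y)
    (s : unitInterval) : concat F G (x, s) = y := by
  simp [concat, hF, hG]

end Concat

section Rel

variable {X : Type*} {Y : Type*} [DiffeologicalSpace X] [DiffeologicalSpace Y] {n : ℕ}

/-- Homotopy of maps on the cube, relative to the boundary. -/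
def HomotopicRel (f g : ICube n → Y) : Prop :=
  ∃ H : ICube n × unitInterval → Y, DSmooth H ∧ (∀ t, H (t, 0) = f t) ∧ (∀ t, H (t, 1) = g t) ∧
    ∀ t ∈ cubeBoundary n, ∀ s, H (t, s) = f t

theorem HomotopicRel.symm {f g : ICube n → Y} (h : HomotopicRel f g) : HomotopicRel g f := by
  obtain ⟨H, hH, h₀, h₁, hb⟩ := h
  refine ⟨fun q => H (q.1, unitInterval.symm q.2), by fun_prop, by simp [h₁], by simp [h₀], ?_⟩
  intro t ht s
  simp only
  rw [hb t ht, ← h₁, hb t ht]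

theorem HomotopicRel.eq_of_mem {f g : ICube n → Y} (h : HomotopicRel f g) {t : ICube n}
    (ht : t ∈ cubeBoundary n) : g t = f t := by
  obtain ⟨H, -, -, h₁, hb⟩ := h
  rw [← h₁, hb t ht]

theorem HomotopicRel.trans {f g k : ICube n → Y} (h : HomotopicRel f g) (h' : HomotopicRel g k) :
    HomotopicRel f k := by
  have hfg := fun t => h.eq_of_mem (t := t)
  obtain ⟨F, hF, hF₀, hF₁, hFb⟩ := h
  obtain ⟨G, hG, hG₀, hG₁, hGb⟩ := h'
  refine ⟨concat F G, dSmooth_concat hF hG fun x => by rw [hF₁, hG₀], fun t => ?_, fun t => ?_,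
    fun t ht s => concat_of_const (hFb t ht) (fun s => ?_) s⟩
  · rw [concat_zero, hF₀]
  · rw [concat_one, hG₁]
  · rw [hGb t ht, hfg t ht]

/-- If `f` is tame on the boundary, then it is homotopic to `f ∘ flatCube ε`. -/
theorem homotopicRel_flatCube {ε : ℝ} (hε : 0 < ε) (hε' : ε ≤ 1 / 4) {f : ICube n → Y}
    (hf : DSmooth f) (h : IsTameWith ε (fun t : cubeBoundary n => f t)) :
    HomotopicRel f (fun t => f (flatCube ε t)) :=
  ⟨fun q => f (flatHtpy ε q.1 q.2), by fun_prop, by simp, by simp,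
    fun t ht s => h.flatHtpy_eq hε hε' ⟨t, ht⟩ s⟩

/-- The lifting problem given by `f` on the cube and by the lift `g` of `f` on its boundary has
a solution up to homotopy relative to the boundary. -/
def Solvable (φ : X → Y) (f : ICube n → Y) (g : cubeBoundary n → X) : Prop :=
  ∃ k : ICube n → X, DSmooth k ∧ (∀ t : cubeBoundary n, k t = g t) ∧
    HomotopicRel f (fun t => φ (k t))

/-- All lifting problems on the `n`-cube with tame boundary values are solvable. -/
def HasCubeLifting (n : ℕ) (φ : X → Y) : Prop :=
  ∀ (f : ICube n → Y) (g : cubeBoundary n → X), DSmooth f → DSmooth g → IsTame g →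
    (∀ t : cubeBoundary n, f t = φ (g t)) → Solvable φ f g

/-- Solvability of a lifting problem is invariant under homotopies of the problem. -/
theorem Solvable.of_homotopy {φ : X → Y} (hφ : DSmooth φ) {f : ICube n × unitInterval → Y}
    {g : cubeBoundary n × unitInterval → X} (hf : DSmooth f) (hg : DSmooth g)
    (hfg : ∀ (t : cubeBoundary n) s, f (t.1, s) = φ (g (t, s)))
    (ht : IsTame (fun t => g (t, 0)))
    (h : Solvable φ (fun t => f (t, 1)) (fun t => g (t, 1))) :
    Solvable φ (fun t => f (t, 0)) (fun t => g (t, 0)) := by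
  obtain ⟨ε, hε, hε', ht⟩ := ht.exists_le
  obtain ⟨k, hk, hkg, H, hH, hH₀, hH₁, hHb⟩ := h
  have hk' : DSmooth (collarExt ε (fun q : ICube n × unitInterval => k q.1)
      (fun q => g (q.1, unitInterval.symm q.2.1))) :=
    dSmooth_collarExt hε hε' (by fun_prop) (by fun_prop) fun t p => by simp [hkg]
  have hH' : DSmooth (collarExt ε H (fun q => φ (g (q.1, unitInterval.symm q.2.1)))) :=
    dSmooth_collarExt hε hε' hH (by fun_prop) fun t p => by
      simp [hHb t t.2, hfg]
  -- The new solution is `k` on an inner cube and `g` run backwards, from time 1 to time 0, through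
  -- the collar. The extra parameter is a dummy, set to 0.
  refine ⟨fun t => collarExt ε (fun q : ICube n × unitInterval => k q.1)
      (fun q => g (q.1, unitInterval.symm q.2.1)) (t, 0), hk'.comp (by fun_prop), ?_, ?_⟩
  · intro t
    simp only
    rw [collarExt_boundary hε hε']
    simpa using ht.flatCube_eq hε hε' t
  have hs : ∀ t : cubeBoundary n, φ (g (⟨_, flatCube_mem hε hε' t.2⟩, 0)) = φ (g (t, 0)) :=
    fun t => congrArg φ (ht.flatCube_eq hε hε' t)
  have e₁ : HomotopicRel (fun t => f (t, 0)) (fun t => f (flatCube ε t, 0)) := by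
    refine homotopicRel_flatCube hε hε' (by fun_prop) ?_
    intro s t j h₁ h₂ h₃
    simpa [hfg] using congrArg φ (ht s t j h₁ h₂ h₃)
  have e₂ : HomotopicRel (fun t => f (flatCube ε t, 0))
      (fun t => f (flatCube ε t, unitInterval.symm (collar ε t))) := by
    refine ⟨fun q => f (flatCube ε q.1, q.2 * unitInterval.symm (collar ε q.1)), by fun_prop,
      by simp, by simp, fun t ht s => ?_⟩
    simp [collar_eq_one ε ht]
  -- After `e₂` the map is `f` at time 1 away from the collar and at time 1 - `collar` in it. There
  -- `H`, extended over the collar by φ ∘ g, begins.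
  refine (e₁.trans e₂).trans
    ⟨collarExt ε H (fun q => φ (g (q.1, unitInterval.symm q.2.1))), hH', fun t => ?_, fun t => ?_,
      fun t ht' s => ?_⟩
  · unfold collarExt
    split_ifs with hc
    · exact (hfg ⟨_, hc⟩ _).symm
    · have : collar ε t = 0 := by
        by_contra h
        exact hc (flatCube_mem_of_collar_ne_zero hε hε' h)
      simp [this, hH₀]
  · unfold collarExt
    simp only
    split_ifs with hc
    · rfl
    · exact hH₁ _
  · rw [collarExt_boundary hε hε' H _ ⟨t, ht'⟩]
    simp only [collar_eq_one ε ht']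
    exact (hfg ⟨_, flatCube_mem hε hε' ht'⟩ _).symm

/-- Solvability of a lifting problem is invariant under homotopies of the cube. -/
theorem Solvable.of_selfMap {φ : X → Y} (hφ : DSmooth φ) {f : ICube n → Y}
    {g : cubeBoundary n → X} (hf : DSmooth f) (hg : DSmooth g)
    (hfg : ∀ t : cubeBoundary n, f t = φ (g t)) {q : ICube n × unitInterval → ICube n}
    (hq : DSmooth q) (hb : ∀ (t : cubeBoundary n) s, q (t.1, s) ∈ cubeBoundary n)
    (ht : IsTame (fun t => g ⟨_, hb t 0⟩))
    (h : Solvable φ (fun t => f (q (t, 1))) (fun t => g ⟨_, hb t 1⟩)) :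
    Solvable φ (fun t => f (q (t, 0))) (fun t => g ⟨_, hb t 0⟩) :=
  Solvable.of_homotopy hφ (f := fun x => f (q x)) (g := fun x => g ⟨q (x.1, x.2), hb x.1 x.2⟩)
    (by fun_prop) (by fun_prop) (fun t s => hfg ⟨q (t, s), hb t s⟩) ht h

theorem Solvable.of_flatCube {φ : X → Y} (hφ : DSmooth φ) {f : ICube n → Y}
    {g : cubeBoundary n → X} (hf : DSmooth f) (hg : DSmooth g)
    (hfg : ∀ t : cubeBoundary n, f t = φ (g t)) {ε : ℝ} (hε : 0 < ε) (hε' : ε ≤ 1 / 4)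
    (ht : IsTame g)
    (h : Solvable φ (fun t => f (flatCube ε t)) (fun t => g ⟨_, flatCube_mem hε hε' t.2⟩)) :
    Solvable φ f g := by
  have := Solvable.of_selfMap hφ hf hg hfg (q := fun x => flatHtpy ε x.1 x.2) (by fun_prop)
    (fun t s => flatHtpy_mem hε hε' t.2 s) (by simpa using ht) (by simpa using h)
  simpa using this

end Rel

/-! ### The decomposition `Iⁿ⁺¹ = Iⁿ × I` -/

section Split

variable {W : Type*} [DiffeologicalSpace W] {m : ℕ}

/-- The point of `Iᵐ⁺¹` with first coordinate `q.2` and the other ones given by `q.1`. -/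
def cubeJoin (q : ICube m × unitInterval) : ICube (m + 1) :=
  cubeMk (Fin.cons q.2 (coord q.1))

/-- The inverse of `cubeJoin`. -/
def cubeSplit (t : ICube (m + 1)) : ICube m × unitInterval :=
  (cubeMk fun i => coord t i.succ, coord t 0)

@[fun_prop]
theorem dSmooth_cubeJoin {f : W → ICube m × unitInterval} (hf : DSmooth f) :
    DSmooth (fun w => cubeJoin (f w)) := by
  refine dSmooth_cubeMk fun i => ?_
  have h₁ : DSmooth (fun w => (f w).1) := dSmooth_fst.comp hf
  have h₂ : DSmooth (fun w => (f w).2) := dSmooth_snd.comp hf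
  refine Fin.cases ?_ (fun i => ?_) i
  · simpa using h₂
  · simp only [Fin.cons_succ]
    fun_prop

@[fun_prop]
theorem dSmooth_cubeSplit {f : W → ICube (m + 1)} (hf : DSmooth f) :
    DSmooth (fun w => cubeSplit (f w)) :=
  dSmooth_prodMk (dSmooth_cubeMk fun i => by fun_prop) (by fun_prop)

@[simp] theorem cubeSplit_cubeJoin (q : ICube m × unitInterval) : cubeSplit (cubeJoin q) = q := by
  refine Prod.ext (cube_ext fun i => ?_) ?_ <;> simp [cubeSplit, cubeJoin]

@[simp] theorem cubeJoin_cubeSplit (t : ICube (m + 1)) : cubeJoin (cubeSplit t) = t := by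
  refine cube_ext fun i => ?_
  refine Fin.cases ?_ (fun i => ?_) i <;> simp [cubeSplit, cubeJoin]

theorem cubeJoin_mem {q : ICube m × unitInterval} :
    cubeJoin q ∈ cubeBoundary (m + 1) ↔ q.1 ∈ cubeBoundary m ∨ q.2 = 0 ∨ q.2 = 1 := by
  rw [mem_cubeBoundary, mem_cubeBoundary, Fin.exists_fin_succ]
  simp only [cubeJoin, coord_cubeMk, Fin.cons_zero, Fin.cons_succ]
  exact or_comm

theorem cubeSplit_mem {t : ICube (m + 1)} :
    t ∈ cubeBoundary (m + 1) ↔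
      (cubeSplit t).1 ∈ cubeBoundary m ∨ (cubeSplit t).2 = 0 ∨ (cubeSplit t).2 = 1 := by
  rw [← cubeJoin_mem, cubeJoin_cubeSplit]

theorem flatCube_cubeJoin (ε : ℝ) (q : ICube m × unitInterval) :
    flatCube ε (cubeJoin q) = cubeJoin (flatCube ε q.1, flat ε q.2) := by
  refine cube_ext fun i => ?_
  refine Fin.cases ?_ (fun i => ?_) i <;> simp [flatCube, cubeJoin]

/-- The homotopy of `Iᵐ⁺¹` from `flatCube ε` which first contracts the first coordinate and then
the other ones. -/
def pushAux (ε : ℝ) (q : ICube m × unitInterval) (v : unitInterval) : ICube (m + 1) :=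
  cubeJoin (cubeMk fun i => unitInterval.symm (stepI (2 * v - 1)) * flat ε (coord q.1 i),
    unitInterval.symm (stepI (2 * v)) * flat ε q.2)

@[fun_prop]
theorem dSmooth_pushAux (ε : ℝ) {f : W → ICube m × unitInterval} {g : W → unitInterval}
    (hf : DSmooth f) (hg : DSmooth g) : DSmooth (fun w => pushAux ε (f w) (g w)) := by
  refine dSmooth_cubeJoin (dSmooth_prodMk (dSmooth_cubeMk fun i => ?_) ?_) <;> fun_prop

/-- The time up to which `pushAux` is run at a given point. -/
def pushTime (ε : ℝ) (q : ICube m × unitInterval) : unitInterval :=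
  unitInterval.symm (unitInterval.symm (collar ε q.1) * q.2)

@[fun_prop]
theorem dSmooth_pushTime (ε : ℝ) {f : W → ICube m × unitInterval} (hf : DSmooth f) :
    DSmooth (fun w => pushTime ε (f w)) := by
  unfold pushTime
  fun_prop

/-- A homotopy of `Iᵐ⁺¹`, preserving the boundary, from `flatCube ε` to a map which collapses
all faces but one to a point. -/
def pushHtpy (ε : ℝ) (x : ICube (m + 1) × unitInterval) : ICube (m + 1) :=
  pushAux ε (cubeSplit x.1) (x.2 * pushTime ε (cubeSplit x.1))

theorem dSmooth_pushHtpy (ε : ℝ) : DSmooth (pushHtpy (m := m) ε) := by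
  unfold pushHtpy
  fun_prop

theorem pushHtpy_zero (ε : ℝ) (t : ICube (m + 1)) : pushHtpy ε (t, 0) = flatCube ε t := by
  rw [← cubeJoin_cubeSplit t, flatCube_cubeJoin]
  simp [pushHtpy, pushAux, stepI_eq_zero, flatCube]

theorem pushHtpy_one (ε : ℝ) {t : ICube (m + 1)}
    (ht : (cubeSplit t).1 ∈ cubeBoundary m ∨ (cubeSplit t).2 = 0) :
    pushHtpy ε (t, 1) = cubeMk fun _ => 0 := by
  have hv : pushTime ε (cubeSplit t) = 1 := by
    rcases ht with h | h
    · simp [pushTime, collar_eq_one ε h]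
    · simp [pushTime, h]
  refine cube_ext fun i => ?_
  simp only [pushHtpy, hv, pushAux]
  rw [stepI_eq_one (by norm_num), stepI_eq_one (by norm_num)]
  refine Fin.cases ?_ (fun i => ?_) i <;> simp [cubeJoin]

/-- The first coordinate reaches 0 before the others start to move, so the point is first held by a
side face and then by the bottom face. -/
theorem pushAux_mem (ε : ℝ) {q : ICube m × unitInterval} (hq : flatCube ε q.1 ∈ cubeBoundary m)
    (v : unitInterval) : pushAux ε q v ∈ cubeBoundary (m + 1) := by
  refine cubeJoin_mem.2 ?_
  by_cases h : 2 * (v : ℝ) - 1 ≤ 0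
  · left
    simp only [stepI_eq_zero h, unitInterval.symm_zero, one_mul]
    exact hq
  · right; left
    simp only
    rw [stepI_eq_one (by linarith)]
    simp

/-- The delicate face is the top one, where `pushTime` equals the collar function of the other
coordinates. Where that vanishes the point stays on the top face; elsewhere flattening has already
put the other coordinates on ∂Iᵐ. -/
theorem pushHtpy_mem {ε : ℝ} (hε : 0 < ε) (hε' : ε ≤ 1 / 4) {t : ICube (m + 1)}
    (ht : t ∈ cubeBoundary (m + 1)) (s : unitInterval) :
    pushHtpy ε (t, s) ∈ cubeBoundary (m + 1) := by
  rcases cubeSplit_mem.1 ht with h | h | h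
  · exact pushAux_mem ε (flatCube_mem hε hε' h) _
  · refine cubeJoin_mem.2 (Or.inr (Or.inl ?_))
    simp [h, flat_zero hε hε']
  · by_cases hc : collar ε (cubeSplit t).1 = 0
    · refine cubeJoin_mem.2 (Or.inr (Or.inr ?_))
      have hv : pushTime ε (cubeSplit t) = 0 := by simp [pushTime, hc, h]
      simp only [hv, h, flat_one hε, mul_zero]
      rw [stepI_eq_zero (by simp)]
      simp
    · exact pushAux_mem ε (flatCube_mem_of_collar_ne_zero hε hε' hc) _

attribute [irreducible] cubeSplit

end Split

/-! ### Lifting problems and homotopy groups -/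

section Group

variable {X : Type*} {Y : Type*} [DiffeologicalSpace X] [DiffeologicalSpace Y] {n m : ℕ}

/-- Because the subspace is a single point, homotopies of pairs into it are homotopies relative to
the boundary. -/
theorem homotopicRel_of_injective {φ : X → Y} {hφ : DSmooth φ} {x : X}
    (h : Function.Injective (homotopyGroupMap n φ hφ x)) {f g : ICube n → X} (hf : DSmooth f)
    (hg : DSmooth g) (hfb : ∀ t ∈ cubeBoundary n, f t = x) (hgb : ∀ t ∈ cubeBoundary n, g t = x)
    (hfg : HomotopicRel (fun t => φ (f t)) (fun t => φ (g t))) : HomotopicRel f g := by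
  let f' : PairMap (cubeBoundary n) ({x} : Set X) := ⟨f, hf, hfb⟩
  let g' : PairMap (cubeBoundary n) ({x} : Set X) := ⟨g, hg, hgb⟩
  obtain ⟨H, hH, h₀, h₁, hb⟩ := hfg
  have e : homotopyGroupMap n φ hφ x (Quotient.mk _ f') =
      homotopyGroupMap n φ hφ x (Quotient.mk _ g') :=
    Quotient.sound (s := homotopySetoid _ _)
      ⟨H, hH, h₀, h₁, fun t ht s => (hb t ht s).trans (congrArg φ (hfb t ht))⟩
  obtain ⟨K, hK, k₀, k₁, kb⟩ := Quotient.exact (h e)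
  exact ⟨K, hK, k₀, k₁, fun t ht s => (kb t ht s).trans (hfb t ht).symm⟩

theorem exists_of_surjective {φ : X → Y} {hφ : DSmooth φ} {x : X}
    (h : Function.Surjective (homotopyGroupMap n φ hφ x)) {f : ICube n → Y} (hf : DSmooth f)
    (hfb : ∀ t ∈ cubeBoundary n, f t = φ x) :
    ∃ k : ICube n → X, DSmooth k ∧ (∀ t ∈ cubeBoundary n, k t = x) ∧
      HomotopicRel f (fun t => φ (k t)) := by
  let f' : PairMap (cubeBoundary n) ({φ x} : Set Y) := ⟨f, hf, hfb⟩
  obtain ⟨k, hk⟩ := h (Quotient.mk _ f')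
  obtain ⟨k, rfl⟩ := Quotient.exists_rep k
  obtain ⟨K, hK, k₀, k₁, kb⟩ := Quotient.exact hk
  exact ⟨k.toFun, k.smooth, fun t ht => k.mapsTo ht,
    HomotopicRel.symm ⟨K, hK, k₀, k₁, fun t ht s =>
      (kb t ht s).trans (congrArg φ (k.mapsTo ht)).symm⟩⟩

theorem homotopicRel_of_split {F G : ICube m × unitInterval → Y}
    (H : (ICube m × unitInterval) × unitInterval → Y) (hH : DSmooth H)
    (h₀ : ∀ q, H (q, 0) = F q) (h₁ : ∀ q, H (q, 1) = G q)
    (hb : ∀ q, q.1 ∈ cubeBoundary m ∨ q.2 = 0 ∨ q.2 = 1 → ∀ s, H (q, s) = F q) :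
    HomotopicRel (fun t => F (cubeSplit t)) (fun t => G (cubeSplit t)) :=
  ⟨fun x => H (cubeSplit x.1, x.2), by fun_prop, fun _ => h₀ _, fun _ => h₁ _,
    fun _ ht s => hb _ (cubeSplit_mem.1 ht) s⟩

/-- A homotopy followed by the inverse of `G` and by `G` itself. -/
theorem homotopicRel_concat_concat {F G : ICube m × unitInterval → Y} {y : Y} (hF : DSmooth F)
    (hG : DSmooth G) (hFG : ∀ t, F (t, 1) = G (t, 1))
    (hFb : ∀ t ∈ cubeBoundary m, ∀ s, F (t, s) = y)
    (hGb : ∀ t ∈ cubeBoundary m, ∀ s, G (t, s) = y) :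
    HomotopicRel (fun t => F (cubeSplit t)) (fun t =>
      concat (concat F (fun q => G (q.1, unitInterval.symm q.2))) G (cubeSplit t)) := by
  -- Reparametrized by `A`, `F` becomes `F` followed by two constant homotopies, which leaves room
  -- for the inverse of `G` and for `G`.
  let A : ICube m × unitInterval → unitInterval :=
    concat (concat (fun p => p.2) (fun _ => 1)) (fun _ => 1)
  have hA : DSmooth A := dSmooth_concat
    (dSmooth_concat dSmooth_snd dSmooth_const fun _ => rfl) dSmooth_const
    fun x => concat_one x
  have hA₀ : ∀ t, A (t, 0) = 0 := fun t => by simp only [A, concat_zero]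
  have hA₁ : ∀ t, A (t, 1) = 1 := fun t => by simp only [A, concat_one]
  have e₁ : HomotopicRel (fun t => F (cubeSplit t))
      (fun t => F ((cubeSplit t).1, A (cubeSplit t))) := by
    refine homotopicRel_of_split (F := F) (G := fun q => F (q.1, A q))
      (fun p => F (p.1.1, lerp p.2 p.1.2 (A p.1))) (by fun_prop) (by simp) (by simp) ?_
    rintro ⟨t, z⟩ (h | h | h) s
    · simp only at h
      simp [hFb t h]
    · simp only at h
      simp [h, hA₀]
    · simp only at h
      simp [h, hA₁]
  -- At deformation parameter s, `G` is traversed from time 1 back to 1 - s and then forth again.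
  refine e₁.trans (homotopicRel_of_split (F := fun q => F (q.1, A q)) (fun p => concat
    (concat (fun x : (ICube m × unitInterval) × unitInterval => F (x.1.1, x.2))
      (fun x => G (x.1.1, lerp x.1.2 1 (unitInterval.symm x.2))))
    (fun x => G (x.1.1, lerp x.1.2 1 x.2)) ((p.1.1, p.2), p.1.2)) ?_ ?_ ?_ ?_)
  · have h₁ := dSmooth_concat
      (F := fun x : (ICube m × unitInterval) × unitInterval => F (x.1.1, x.2))
      (G := fun x => G (x.1.1, lerp x.1.2 1 (unitInterval.symm x.2))) (by fun_prop) (by fun_prop)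
      (fun x => by simp [hFG])
    have h₂ := dSmooth_concat h₁
      (G := fun x => G (x.1.1, lerp x.1.2 1 x.2)) (by fun_prop)
      (fun x => by rw [concat_one]; simp)
    have h₃ : DSmooth (fun p : (ICube m × unitInterval) × unitInterval =>
      ((p.1.1, p.2), p.1.2)) := by fun_prop
    exact h₂.comp h₃
  · rintro ⟨t, z⟩
    simp only [A, concat, lerp_zero, ← hFG]
    split_ifs <;> rfl
  · rintro ⟨t, z⟩
    simp only [concat, lerp_one]
  · rintro ⟨t, z⟩ (h | h | h) s
    · simp only at h
      simp only [hFb t h]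
      refine concat_of_const (fun s => ?_) (fun s => ?_) _
      · refine concat_of_const (fun s => ?_) (fun s => ?_) _
        · exact hFb t h _
        · exact hGb t h _
      · exact hGb t h _
    · simp only at h
      simp only [h, concat_zero, hA₀]
    · simp only at h
      simp only [h, concat_one, hA₁, lerp_self, hFG]

/-- Lifting problems whose boundary values are constant on all faces but one. -/
theorem solvable_of_eq_const {φ : X → Y} (hφ : DSmooth φ) {x : X}
    (hinj : Function.Injective (homotopyGroupMap m φ hφ x))
    (hsurj : Function.Surjective (homotopyGroupMap (m + 1) φ hφ x))
    {f : ICube (m + 1) → Y} {g : cubeBoundary (m + 1) → X} (hf : DSmooth f) (hg : DSmooth g)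
    (hfg : ∀ t : cubeBoundary (m + 1), f t = φ (g t))
    (hx : ∀ t : cubeBoundary (m + 1),
      (cubeSplit t.1).1 ∈ cubeBoundary m ∨ (cubeSplit t.1).2 = 0 → g t = x) :
    Solvable φ f g := by
  have hF : DSmooth (fun q : ICube m × unitInterval => f (cubeJoin q)) := by fun_prop
  have hF₀ : ∀ t : ICube m, f (cubeJoin (t, 0)) = φ x := fun t => by
    rw [← hx ⟨cubeJoin (t, 0), cubeJoin_mem.2 (by simp)⟩ (by simp)]
    exact hfg ⟨cubeJoin (t, 0), _⟩
  have hFb : ∀ t ∈ cubeBoundary m, ∀ s, f (cubeJoin (t, s)) = φ x := fun t ht s => by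
    rw [← hx ⟨cubeJoin (t, s), cubeJoin_mem.2 (by simp [ht])⟩ (by simp [ht])]
    exact hfg ⟨cubeJoin (t, s), _⟩
  have htop : ∀ t : ICube m, cubeJoin (t, 1) ∈ cubeBoundary (m + 1) :=
    fun t => cubeJoin_mem.2 (by simp)
  have ha : DSmooth (fun t : ICube m => g ⟨cubeJoin (t, 1), htop t⟩) := by fun_prop
  -- Read as a homotopy in the first coordinate, `f` joins the constant map to φ ∘ g on the top
  -- face; injectivity on π_m gives such a homotopy in `X`.
  obtain ⟨G, hG, hG₀, hG₁, hGb⟩ : HomotopicRel (fun _ : ICube m => x)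
      (fun t : ICube m => g ⟨cubeJoin (t, 1), htop t⟩) := by
    refine homotopicRel_of_injective hinj dSmooth_const ha (fun _ _ => rfl)
      (fun t ht => hx _ (by simp [ht]))
      ⟨fun q => f (cubeJoin q), hF, hF₀, fun t => hfg ⟨_, htop t⟩, hFb⟩
  have hφG : DSmooth (fun q => φ (G q)) := by fun_prop
  have hFG : ∀ t : ICube m, f (cubeJoin (t, 1)) = φ (G (t, 1)) := fun t => by
    rw [hG₁]; exact hfg ⟨_, htop t⟩
  have hD : DSmooth (concat (fun q : ICube m × unitInterval => f (cubeJoin q))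
      (fun q => φ (G (q.1, unitInterval.symm q.2)))) :=
    dSmooth_concat hF (by fun_prop) fun t => by simp [hFG]
  -- Followed by the inverse of φ ∘ G, `f` is constant on the whole boundary and represents a class
  -- in π_{m+1}, lifted here to `b`. The solution is `b` followed by `G`.
  obtain ⟨b, hb, hbx, hbD⟩ := exists_of_surjective hsurj
    (f := fun t => concat (fun q : ICube m × unitInterval => f (cubeJoin q))
      (fun q => φ (G (q.1, unitInterval.symm q.2))) (cubeSplit t)) (hD.comp (by fun_prop)) (by
        intro t ht
        generalize hq : cubeSplit t = q
        obtain ⟨t', z⟩ := q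
        rcases cubeSplit_mem.1 ht with h | h | h <;> rw [hq] at h <;> simp only at h
        · exact concat_of_const (hFb t' h) (fun s => congrArg φ (hGb t' h _)) z
        · rw [h, concat_zero, hF₀]
        · rw [h, concat_one]; simp [hG₀])
  have hk : DSmooth (concat (fun q => b (cubeJoin q)) G) :=
    dSmooth_concat (by fun_prop) hG fun t => by
      rw [hG₀, hbx _ (htop t)]
  refine ⟨fun t => concat (fun q => b (cubeJoin q)) G (cubeSplit t), hk.comp (by fun_prop), ?_, ?_⟩
  · rintro ⟨t, ht⟩
    obtain ⟨⟨t', z⟩, rfl⟩ : ∃ q, cubeJoin q = t := ⟨_, cubeJoin_cubeSplit t⟩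
    simp only [cubeSplit_cubeJoin]
    rcases cubeJoin_mem.1 ht with h | h | h <;> simp only at h
    · rw [hx _ (by simp [h])]
      exact concat_of_const (fun s => hbx _ (cubeJoin_mem.2 (by simp [h]))) (hGb t' h) z
    · subst h
      rw [concat_zero, hx _ (by simp), hbx _ ht]
    · subst h
      rw [concat_one, hG₁]
  · have e₁ := homotopicRel_concat_concat hF hφG hFG hFb
      (fun t ht s => congrArg φ (hGb t ht s))
    simp only [cubeJoin_cubeSplit] at e₁
    refine e₁.trans ?_
    obtain ⟨H, hH, hH₀, hH₁, hHb⟩ := hbD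
    have e₂ := homotopicRel_of_split
      (F := concat (concat (fun q : ICube m × unitInterval => f (cubeJoin q))
        (fun q => φ (G (q.1, unitInterval.symm q.2)))) (fun q => φ (G q)))
      (G := fun q => φ (concat (fun q => b (cubeJoin q)) G q))
      (fun p => concat
        (fun x : (ICube m × unitInterval) × unitInterval => H (cubeJoin (x.1.1, x.2), x.1.2))
        (fun x => φ (G (x.1.1, x.2))) ((p.1.1, p.2), p.1.2)) ?_ ?_ ?_ ?_
    · exact e₂
    · refine (dSmooth_concat (F := fun x : (ICube m × unitInterval) × unitInterval =>
        H (cubeJoin (x.1.1, x.2), x.1.2)) (by fun_prop) (G := fun x => φ (G (x.1.1, x.2)))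
        (by fun_prop) fun y => ?_).comp (by fun_prop)
      rw [hHb _ (htop y.1)]
      simp [concat_one]
    · rintro ⟨t, z⟩
      simp only [concat, hH₀, cubeSplit_cubeJoin]
    · rintro ⟨t, z⟩
      simp only [concat, hH₁]
      split_ifs <;> rfl
    · rintro ⟨t, z⟩ h s
      simp only at h
      rcases h with h | h | h
      · have h₁ : ∀ z s, H (cubeJoin (t, z), s) = φ x := fun z s => by
          rw [hHb _ (cubeJoin_mem.2 (by simp [h]))]
          simp only [cubeSplit_cubeJoin]
          exact concat_of_const (hFb t h) (fun s => congrArg φ (hGb t h _)) z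
        simp only
        rw [concat_of_const (y := φ x) (fun z => h₁ z s) (fun z => congrArg φ (hGb t h _)),
          concat_of_const (y := φ x)]
        · exact concat_of_const (hFb t h) (fun s => congrArg φ (hGb t h _))
        · exact fun s => congrArg φ (hGb t h _)
      · subst h
        simp only [concat_zero]
        rw [hHb _ (cubeJoin_mem.2 (by simp))]
        simp [concat_zero]
      · subst h
        simp only [concat_one]

theorem hasCubeLifting_zero {φ : X → Y} (hφ : DSmooth φ) (x : X)
    (hsurj : Function.Surjective (homotopyGroupMap 0 φ hφ x)) : HasCubeLifting 0 φ := by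
  intro f g hf hg ht hfg
  have hb : ∀ t : ICube 0, t ∉ cubeBoundary 0 := fun t ht => by
    obtain ⟨i, -⟩ := ht
    exact i.elim0
  obtain ⟨k, hk, -, hk'⟩ := exists_of_surjective hsurj hf fun t ht => (hb t ht).elim
  exact ⟨k, hk, fun t => (hb t t.2).elim, hk'⟩

theorem hasCubeLifting_succ {φ : X → Y} (hφ : DSmooth φ)
    (hinj : ∀ x, Function.Injective (homotopyGroupMap m φ hφ x))
    (hsurj : ∀ x, Function.Surjective (homotopyGroupMap (m + 1) φ hφ x)) :
    HasCubeLifting (m + 1) φ := by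
  intro f g hf hg ht hfg
  have hε : (0 : ℝ) < 1 / 4 := by norm_num
  -- `pushHtpy` starts at `flatCube`, not at the identity, so the problem is flattened first.
  refine Solvable.of_flatCube hφ hf hg hfg hε le_rfl ht ?_
  have hz : (cubeMk fun _ => 0 : ICube (m + 1)) ∈ cubeBoundary (m + 1) :=
    mem_cubeBoundary.2 ⟨0, by simp⟩
  have key := Solvable.of_selfMap hφ hf hg hfg (dSmooth_pushHtpy (1 / 4))
    (fun t s => pushHtpy_mem hε le_rfl t.2 s) ?_ ?_
  · simpa only [pushHtpy_zero] using key
  · simp only [pushHtpy_zero]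
    exact isTame_of_flatCube hε le_rfl g
  · refine solvable_of_eq_const hφ (hinj _) (hsurj (g ⟨_, hz⟩)) ?_ ?_ 
      (fun t => hfg ⟨_, pushHtpy_mem hε le_rfl t.2 1⟩) ?_
    · exact hf.comp ((dSmooth_pushHtpy _).comp (by fun_prop))
    · exact hg.comp (dSmooth_subtype ((dSmooth_pushHtpy _).comp (by fun_prop)))
    · intro t h
      simp only [pushHtpy_one _ h]

/-- For n = 0 the boundary is empty and supplies no base point; the nonemptiness clause does. -/
theorem IsNEquivalence.hasCubeLifting {N : ℕ} {φ : X → Y} (h : IsNEquivalence N φ) (hn : n ≤ N) :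
    HasCubeLifting n φ := by
  cases n with
  | zero =>
    intro f g hf hg ht hfg
    obtain ⟨x⟩ := h.nonempty ⟨f (cubeMk fun _ => 0)⟩
    exact hasCubeLifting_zero h.smooth x (h.surjective x 0 hn) f g hf hg ht hfg
  | succ m =>
    exact hasCubeLifting_succ h.smooth (fun x => h.injective x m hn)
      fun x => h.surjective x (m + 1) hn

end Group

/-! ### Lifting problems for path spaces -/

section PathLifting

variable {X : Type*} {Y : Type*} [DiffeologicalSpace X] [DiffeologicalSpace Y] {n : ℕ}

/-- Pairs of points of `X` together with a path in `Y` between their images. -/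
abbrev PathPullback (φ : X → Y) : Type _ :=
  {p : (X × X) × SPath Y // p.2.toFun 0 = φ p.1.1 ∧ p.2.toFun 1 = φ p.1.2}

/-- The image of a path under a smooth map. -/
def SPath.map {φ : X → Y} (hφ : DSmooth φ) (γ : SPath X) : SPath Y :=
  ⟨fun s => φ (γ.toFun s), hφ.comp γ.smooth⟩

@[fun_prop]
theorem dSmooth_pathMap {φ : X → Y} (hφ : DSmooth φ) : DSmooth (SPath.map hφ) := by
  refine dSmooth_path ?_
  unfold SPath.map
  fun_prop

/-- The map sending a path to its end points and its image. -/
def pathPullbackMap {φ : X → Y} (hφ : DSmooth φ) (γ : SPath X) : PathPullback φ :=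
  ⟨((γ.toFun 0, γ.toFun 1), γ.map hφ), rfl, rfl⟩

theorem dSmooth_pathPullbackMap {φ : X → Y} (hφ : DSmooth φ) : DSmooth (pathPullbackMap hφ) := by
  unfold pathPullbackMap
  fun_prop

/-- The homotopy which makes paths constant near their end points. -/
def SPath.flatten (ε : ℝ) (γ : SPath X) (u : unitInterval) : SPath X :=
  ⟨fun s => γ.toFun (lerp u s (flat ε s)), by
    have := γ.smooth
    fun_prop⟩

@[fun_prop]
theorem dSmooth_flatten {W : Type*} [DiffeologicalSpace W] (ε : ℝ) {f : W → SPath X}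
    {g : W → unitInterval} (hf : DSmooth f) (hg : DSmooth g) :
    DSmooth (fun w => (f w).flatten ε (g w)) := by
  refine dSmooth_path ?_
  unfold SPath.flatten
  fun_prop

theorem SPath.flatten_zero (ε : ℝ) (γ : SPath X) : γ.flatten ε 0 = γ := by
  ext s
  simp [SPath.flatten]

/-- By adjunction the paths in `Y` form a map `F` on Iⁿ⁺¹. Its lift `G` on the boundary consists of
`g` on the sides and of the two end points on bottom and top. Smoothness of `G` at the corners is
not clear, so cube and paths are flattened beforehand. A solution has a homotopy relative to the
boundary, hence one fixing the end points of the paths. -/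
theorem HasCubeLifting.path {φ : X → Y} (hφ : DSmooth φ) (h : HasCubeLifting (n + 1) φ) :
    HasCubeLifting n (pathPullbackMap hφ) := by
  classical
  intro f g hf hg ht hfg
  obtain ⟨ε, hε, hε'⟩ : ∃ ε : ℝ, 0 < ε ∧ ε ≤ 1 / 4 := ⟨1 / 4, by norm_num, le_rfl⟩
  have hf₀ : ∀ t, (f t).1.2.toFun 0 = φ (f t).1.1.1 := fun t => (f t).2.1
  have hf₁ : ∀ t, (f t).1.2.toFun 1 = φ (f t).1.1.2 := fun t => (f t).2.2
  have hg₀ : ∀ t : cubeBoundary n, (g t).toFun 0 = (f t).1.1.1 := fun t => by rw [hfg]; rfl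
  have hg₁ : ∀ t : cubeBoundary n, (g t).toFun 1 = (f t).1.1.2 := fun t => by rw [hfg]; rfl
  have hgφ : ∀ (t : cubeBoundary n) s, φ ((g t).toFun s) = (f t).1.2.toFun s :=
    fun t s => by rw [hfg]; rfl
  have hx₀ : DSmooth (fun t => (f t).1.1.1) := by fun_prop
  have hx₁ : DSmooth (fun t => (f t).1.1.2) := by fun_prop
  have hδ : DSmooth (fun t => (f t).1.2) := by fun_prop
  have flat₀ : flat ε 0 = 0 := flat_zero hε hε'
  have flat₁ : flat ε 1 = 1 := flat_one hε
  let f' : ICube n × unitInterval → PathPullback φ := fun q =>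
    ⟨((f (flatHtpy ε q.1 q.2)).1.1, (f (flatHtpy ε q.1 q.2)).1.2.flatten ε q.2),
      by simp [SPath.flatten, flat₀, hf₀], by simp [SPath.flatten, flat₁, hf₁]⟩
  let g' : cubeBoundary n × unitInterval → SPath X := fun q =>
    (g ⟨_, flatHtpy_mem hε hε' q.1.2 q.2⟩).flatten ε q.2
  have key := Solvable.of_homotopy (dSmooth_pathPullbackMap hφ) (f := f') (g := g')
    (by fun_prop) (by fun_prop) ?_ ?_ ?_
  · simpa [f', g', SPath.flatten_zero] using key
  · intro t s
    refine Subtype.ext (Prod.ext (Prod.ext ?_ ?_) (SPath.ext (funext fun z => ?_)))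
    · simp [f', g', pathPullbackMap, SPath.flatten, flat₀, hg₀]
    · simp [f', g', pathPullbackMap, SPath.flatten, flat₁, hg₁]
    · simp [f', g', pathPullbackMap, SPath.flatten, SPath.map, hgφ]
  · simpa [g', SPath.flatten_zero] using ht
  let F : ICube (n + 1) → Y := fun t => (f (cubeSplit t).1).1.2.toFun (cubeSplit t).2
  have hF : DSmooth F := by fun_prop
  let G : cubeBoundary (n + 1) → X := fun t =>
    if ht : (cubeSplit t.1).1 ∈ cubeBoundary n then (g ⟨_, ht⟩).toFun (cubeSplit t.1).2
    else if (cubeSplit t.1).2 = 0 then (f (cubeSplit t.1).1).1.1.1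
    else (f (cubeSplit t.1).1).1.1.2
  have hG₀ : ∀ t : cubeBoundary (n + 1), (cubeSplit t.1).2 = 0 →
      G t = (f (cubeSplit t.1).1).1.1.1 := by
    intro t ht
    simp only [G, ht, if_true, hg₀]
    split_ifs <;> rfl
  have hG₁ : ∀ t : cubeBoundary (n + 1), (cubeSplit t.1).2 = 1 →
      G t = (f (cubeSplit t.1).1).1.1.2 := by
    intro t ht
    simp only [G, ht, hg₁]
    simp
  have hGs : ∀ (t : cubeBoundary (n + 1)) (ht : (cubeSplit t.1).1 ∈ cubeBoundary n),
      G t = (g ⟨_, ht⟩).toFun (cubeSplit t.1).2 := fun t ht => dif_pos ht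
  have hFG : ∀ t : cubeBoundary (n + 1), F t = φ (G t) := by
    intro t
    rcases cubeSplit_mem.1 t.2 with h | h | h
    · rw [hGs t h, hgφ]
    · rw [hG₀ t h, ← hf₀]
      simp only [F, h]
    · rw [hG₁ t h, ← hf₁]
      simp only [F, h]
  have hm : ∀ t : cubeBoundary (n + 1), flatCube ε t.1 ∈ cubeBoundary (n + 1) :=
    fun t => flatCube_mem hε hε' t.2
  have hsp : ∀ t : ICube (n + 1), cubeSplit (flatCube ε t) =
      (flatCube ε (cubeSplit t).1, flat ε (cubeSplit t).2) := fun t => by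
    rw [← cubeSplit_cubeJoin (flatCube ε (cubeSplit t).1, flat ε (cubeSplit t).2),
      ← flatCube_cubeJoin]
    simp
  have hG : DSmooth (fun t : cubeBoundary (n + 1) => G ⟨_, hm t⟩) := by
    -- Three regions: near the bottom, near the top, and strictly between, where a boundary point
    -- lies on a side. Each has a single smooth formula.
    refine dSmooth_of_locally fun t => ?_
    by_cases h₀ : (cubeSplit t.1).2 = 0
    · refine ⟨fun t => ε / 2 - (cubeSplit t.1).2, by fun_prop, by simpa [h₀] using hε, ?_⟩
      have e : (fun x : {t : cubeBoundary (n + 1) // 0 < ε / 2 - ((cubeSplit t.1).2 : ℝ)} =>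
          G ⟨_, hm x⟩) = fun x => (f (flatCube ε (cubeSplit x.1.1).1)).1.1.1 := by
        funext x
        rw [hG₀ _ (by
          rw [hsp]; exact flat_eq_zero hε hε' (by have := x.2; linarith)), hsp]
      rw [e]
      fun_prop
    by_cases h₁ : (cubeSplit t.1).2 = 1
    · refine ⟨fun t => (cubeSplit t.1).2 - (1 - ε / 2), by fun_prop, by
        simp only [h₁, Set.Icc.coe_one]; linarith, ?_⟩
      have e : (fun x : {t : cubeBoundary (n + 1) // 0 < ((cubeSplit t.1).2 : ℝ) - (1 - ε / 2)} =>
          G ⟨_, hm x⟩) = fun x => (f (flatCube ε (cubeSplit x.1.1).1)).1.1.2 := by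
        funext x
        rw [hG₁ _ (by
          rw [hsp]; exact flat_eq_one hε (by have := x.2; linarith)), hsp]
      rw [e]
      fun_prop
    · refine ⟨fun t => (cubeSplit t.1).2 * (1 - (cubeSplit t.1).2), by fun_prop, ?_, ?_⟩
      · refine mul_pos (unitInterval.pos_iff_ne_zero.2 h₀) (sub_pos.2 ?_)
        exact unitInterval.lt_one_iff_ne_one.2 h₁
      · have hs : ∀ x : {t : cubeBoundary (n + 1) //
            0 < ((cubeSplit t.1).2 : ℝ) * (1 - (cubeSplit t.1).2)},
            flatCube ε (cubeSplit x.1.1).1 ∈ cubeBoundary n := by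
          rintro ⟨x, hx⟩
          rcases cubeSplit_mem.1 x.2 with h | h | h
          · exact flatCube_mem hε hε' h
          · simp [h] at hx
          · simp [h] at hx
        have e : (fun x : {t : cubeBoundary (n + 1) //
            0 < ((cubeSplit t.1).2 : ℝ) * (1 - (cubeSplit t.1).2)} => G ⟨_, hm x⟩) =
            fun x => (g ⟨_, hs x⟩).toFun (flat ε (cubeSplit x.1.1).2) := by
          funext x
          rw [hGs _ (by rw [hsp]; exact hs x)]
          simp only [hsp]
        rw [e]
        fun_prop
  obtain ⟨k, hk, hkG, H, hH, hH₀, hH₁, hHb⟩ := h (fun t => F (flatCube ε t))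
    (fun t => G ⟨_, hm t⟩) (by fun_prop) hG (isTame_of_flatCube hε hε' G) (fun t => hFG ⟨_, hm t⟩)
  dsimp only at hkG hH₀ hH₁ hHb
  have hm₀ : ∀ t : ICube n, cubeJoin (t, 0) ∈ cubeBoundary (n + 1) :=
    fun t => cubeJoin_mem.2 (by simp)
  have hm₁ : ∀ t : ICube n, cubeJoin (t, 1) ∈ cubeBoundary (n + 1) :=
    fun t => cubeJoin_mem.2 (by simp)
  have hFf : ∀ t s, F (flatCube ε (cubeJoin (t, s))) =
      (f (flatCube ε t)).1.2.toFun (flat ε s) := fun t s => by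
    simp only [F, hsp, cubeSplit_cubeJoin]
  have hk₀ : ∀ t, k (cubeJoin (t, 0)) = (f (flatCube ε t)).1.1.1 := fun t => by
    rw [hkG ⟨_, hm₀ t⟩, hG₀ _ (by simp [hsp, flat₀])]
    simp [hsp]
  have hk₁ : ∀ t, k (cubeJoin (t, 1)) = (f (flatCube ε t)).1.1.2 := fun t => by
    rw [hkG ⟨_, hm₁ t⟩, hG₁ _ (by simp [hsp, flat₁])]
    simp [hsp]
  have hkJ : DSmooth (fun q : ICube n × unitInterval => k (cubeJoin q)) := by fun_prop
  have hHJ : DSmooth (fun q : (ICube n × unitInterval) × unitInterval =>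
      H (cubeJoin (q.1.1, q.2), q.1.2)) := by fun_prop
  refine ⟨curryPath _ hkJ, dSmooth_curryPath hkJ, fun t => ?_, fun q =>
    ⟨((f (flatCube ε q.1)).1.1, curryPath _ hHJ q), ?_, ?_⟩, ?_, fun t => ?_, fun t => ?_,
    fun t ht s => ?_⟩
  · refine SPath.ext (funext fun s => ?_)
    have hts : cubeJoin (t.1, s) ∈ cubeBoundary (n + 1) := cubeJoin_mem.2 (by simp)
    simp only [curryPath, g', SPath.flatten, flatHtpy_one, lerp_one]
    rw [hkG ⟨_, hts⟩, hGs ⟨_, hm ⟨_, hts⟩⟩ (by rw [hsp]; simpa using flatCube_mem hε hε' t.2)]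
    simp [hsp]
  · simp only [curryPath]
    rw [hHb _ (hm₀ _), hFf, flat₀, hf₀]
  · simp only [curryPath]
    rw [hHb _ (hm₁ _), hFf, flat₁, hf₁]
  · have := dSmooth_curryPath hHJ
    fun_prop
  · refine Subtype.ext (Prod.ext ?_ (SPath.ext (funext fun s => ?_)))
    · simp [f']
    · simp [f', curryPath, hH₀, hFf, SPath.flatten]
  · refine Subtype.ext (Prod.ext (Prod.ext ?_ ?_) (SPath.ext (funext fun s => ?_)))
    · simp [pathPullbackMap, curryPath, hk₀]
    · simp [pathPullbackMap, curryPath, hk₁]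
    · simp [pathPullbackMap, curryPath, hH₁, SPath.map]
  · refine Subtype.ext (Prod.ext ?_ (SPath.ext (funext fun z => ?_)))
    · simp [f']
    · simp only [f', curryPath, SPath.flatten, flatHtpy_one, lerp_one]
      rw [hHb _ (cubeJoin_mem.2 (by simp [ht])), hFf]

end PathLifting

/-! ### Lifting of pairs -/

section Pair

variable {X : Type*} {Y : Type*} [DiffeologicalSpace X] [DiffeologicalSpace Y] {n : ℕ}

/-- Given `f` on the `n`-cube with values in `B` and a homotopy `h` on the boundary, in `B`, from
`f` to `φ ∘ g` for some `g` with values in `A`, the map `g` extends to the cube, and so does `h`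
up to a reparametrization. -/
def HasPairLifting (n : ℕ) (φ : X → Y) (A : Set X) (B : Set Y) : Prop :=
  ∀ (f : ICube n → Y) (g : cubeBoundary n → X) (h : cubeBoundary n × unitInterval → Y),
    DSmooth f → DSmooth g → DSmooth h → IsTame (fun t => (g t, fun s => h (t, s))) →
    (∀ t, f t ∈ B) → (∀ t, g t ∈ A) → (∀ q, h q ∈ B) → (∀ t, h (t, 0) = f t.1) →
    (∀ t, h (t, 1) = φ (g t)) →
    ∃ (k : ICube n → X) (H : ICube n × unitInterval → Y), DSmooth k ∧ DSmooth H ∧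
      (∀ t, k t ∈ A) ∧ (∀ q, H q ∈ B) ∧ (∀ t : cubeBoundary n, k t = g t) ∧
      (∀ t, H (t, 0) = f t) ∧ (∀ t, H (t, 1) = φ (k t)) ∧
      ∀ (t : cubeBoundary n) s, H (t.1, s) =
        concat (fun q => f q.1.1) (concat h (fun q => φ (g q.1))) (t, s)

/-- Running `h` through a collar turns `f ∘ flatCube` into a map with boundary values φ ∘ g, to
which cube lifting applies. Passing from `f` to `f ∘ flatCube` and the final relative homotopy are
constant on the boundary; they give the outer pieces of the boundary formula. -/
theorem HasCubeLifting.hasPairLifting_univ {φ : X → Y} (hn : HasCubeLifting n φ) :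
    HasPairLifting n φ Set.univ Set.univ := by
  intro f g h hf hg hh ht _ _ _ h₀ h₁
  obtain ⟨ε, hε, hε', ht⟩ := ht.exists_le
  have htg : IsTameWith ε g := fun s t j a b c => congrArg Prod.fst (ht s t j a b c)
  have hth : ∀ s, IsTameWith ε (fun t => h (t, s)) :=
    fun s s' t j a b c => congrFun (congrArg Prod.snd (ht s' t j a b c)) s
  let E : ICube n × unitInterval → Y :=
    collarExt ε (fun q => f q.1) (fun q => h (q.1, q.2.1 * q.2.2))
  have hE : DSmooth E := dSmooth_collarExt hε hε' (by fun_prop) (by fun_prop) (by simp [h₀])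
  have hE₀ : ∀ t, E (t, 0) = f (flatCube ε t) :=
    fun t => collarExt_of_const (by simp [h₀]) t
  have hEb : ∀ (t : cubeBoundary n) s, E (t.1, s) = h (t, s) := fun t s => by
    simp only [E]
    rw [collarExt_boundary hε hε', one_mul]
    exact (hth s).flatCube_eq hε hε' t
  obtain ⟨k, hk, hkg, K, hK, hK₀, hK₁, hKb⟩ := hn (fun t => E (t, 1)) g (by fun_prop) hg
    ⟨ε, hε, by linarith, htg⟩ fun t => by rw [hEb, h₁]
  have hf' : DSmooth (fun q : ICube n × unitInterval => f (flatHtpy ε q.1 q.2)) := by fun_prop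
  have hEK : DSmooth (concat E K) := dSmooth_concat hE hK fun t => (hK₀ t).symm
  refine ⟨k, concat (fun q => f (flatHtpy ε q.1 q.2)) (concat E K), hk,
    dSmooth_concat hf' hEK fun t => by rw [concat_zero, hE₀, flatHtpy_one],
    fun _ => trivial, fun _ => trivial, hkg, fun t => ?_, fun t => ?_, fun t s => ?_⟩
  · rw [concat_zero, flatHtpy_zero]
  · rw [concat_one, concat_one, hK₁]
  · have e₁ : ∀ s, f (flatHtpy ε t.1 s) = f t.1 := fun s => by
      have := (hth 0).flatHtpy_eq hε hε' t s
      simpa only [h₀] using this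
    simp only [concat, e₁, hEb, hKb _ t.2, h₁]

/-- `i` identifies `X` with the subspace `A`. -/
structure IsSubspaceMap {X' : Type*} [DiffeologicalSpace X'] (i : X' → X) (A : Set X) : Prop where
  smooth : DSmooth i
  injective : Function.Injective i
  mem : ∀ x, i x ∈ A
  exists_lift : ∀ {W : Type} [DiffeologicalSpace W] (f : W → X), DSmooth f → (∀ w, f w ∈ A) →
    ∃ f' : W → X', DSmooth f' ∧ ∀ w, i (f' w) = f w

theorem isSubspaceMap_val (A : Set X) : IsSubspaceMap (Subtype.val : A → X) A where
  smooth := dSmooth_val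
  injective := Subtype.val_injective
  mem x := x.2
  exists_lift f hf hA := ⟨fun w => ⟨f w, hA w⟩, dSmooth_subtype hf, fun _ => rfl⟩

variable {X' : Type*} {Y' : Type*} [DiffeologicalSpace X'] [DiffeologicalSpace Y']

theorem HasCubeLifting.hasPairLifting {φ : X → Y} {A : Set X} {B : Set Y} {φ' : X' → Y'}
    {i : X' → X} {j : Y' → Y} (hi : IsSubspaceMap i A) (hj : IsSubspaceMap j B)
    (hij : ∀ x, φ (i x) = j (φ' x)) (hn : HasCubeLifting n φ') : HasPairLifting n φ A B := by
  intro f g h hf hg hh ht hfB hgA hhB h₀ h₁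
  obtain ⟨f', hf', ef⟩ := hj.exists_lift f hf hfB
  obtain ⟨g', hg', eg⟩ := hi.exists_lift g hg hgA
  obtain ⟨h', hh', eh⟩ := hj.exists_lift h hh hhB
  have ht' : IsTame (fun t => (g' t, fun s => h' (t, s))) := by
    obtain ⟨ε, hε, hε', ht⟩ := ht
    refine ⟨ε, hε, hε', fun s t k a b c => ?_⟩
    have := ht s t k a b c
    simp only [Prod.mk.injEq, funext_iff, ← eg, ← eh, hi.injective.eq_iff,
      hj.injective.eq_iff] at this ⊢
    exact this
  obtain ⟨k, H, hk, hH, -, -, hkg, hH₀, hH₁, hHb⟩ := hn.hasPairLifting_univ f' g' h' hf' hg' hh'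
    ht' (fun _ => trivial) (fun _ => trivial) (fun _ => trivial)
    (fun t => hj.injective (by rw [eh, ef, h₀]))
    (fun t => hj.injective (by rw [eh, ← hij, eg, h₁]))
  refine ⟨fun t => i (k t), fun q => j (H q), hi.smooth.comp hk, hj.smooth.comp hH,
    fun t => hi.mem _, fun q => hj.mem _, fun t => by simp only [hkg, eg],
    fun t => by simp only [hH₀, ef], fun t => by simp only [hH₁, hij], fun t s => ?_⟩
  simp only [hHb, concat, ← ef, ← eg, ← eh, hij]
  split_ifs <;> rfl

theorem PairMap.IsNEquivalence.hasPairLifting_univ {A : Set X} {B : Set Y} {N : ℕ}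
    {φ : PairMap A B} (hφ : φ.IsNEquivalence N) (hn : n ≤ N) :
    HasPairLifting n φ.toFun Set.univ Set.univ :=
  (hφ.1.hasCubeLifting hn).hasPairLifting_univ

theorem PairMap.IsNEquivalence.hasPairLifting {A : Set X} {B : Set Y} {N : ℕ}
    {φ : PairMap A B} (hφ : φ.IsNEquivalence N) (hn : n ≤ N) :
    HasPairLifting n φ.toFun A B :=
  (hφ.2.hasCubeLifting hn).hasPairLifting (isSubspaceMap_val A) (isSubspaceMap_val B)
    fun _ => rfl

end Pair

/-! ### Pairs of path spaces -/

section PathPair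

variable {X : Type*} {Y : Type*} [DiffeologicalSpace X] [DiffeologicalSpace Y] {n : ℕ}

/-- The paths inside a subset. -/
def pathSet (A : Set X) : Set (SPath X) := {γ | ∀ s, γ.toFun s ∈ A}

/-- The elements of `PathPullback φ` all of whose components lie in the given subsets. -/
def pathPullbackSet (φ : X → Y) (A : Set X) (B : Set Y) : Set (PathPullback φ) :=
  {p | p.1.1.1 ∈ A ∧ p.1.1.2 ∈ A ∧ p.1.2 ∈ pathSet B}

/-- Currying identifies paths in the subspace with paths lying in it, so lifting for the subspaces
of path spaces can be borrowed from the restriction A → B. -/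
theorem isSubspaceMap_path (A : Set X) :
    IsSubspaceMap (SPath.map (dSmooth_val (P := (· ∈ A)))) (pathSet A) where
  smooth := dSmooth_pathMap _
  injective γ γ' h := SPath.ext (funext fun s =>
    Subtype.ext (congrFun (congrArg SPath.toFun h) s))
  mem γ s := (γ.toFun s).2
  exists_lift {W} _ f hf hA := by
    have h : DSmooth (fun q : W × unitInterval => (⟨(f q.1).toFun q.2, hA q.1 q.2⟩ : A)) := by fun_prop
    exact ⟨curryPath _ h, dSmooth_curryPath h, fun _ => rfl⟩

/-- The inclusion of the pullback formed for the restriction of `φ`. -/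
def pathPullbackIncl {A : Set X} {B : Set Y} (φ : PairMap A B)
    (p : PathPullback (φ.mapsTo.restrict φ.toFun A B)) : PathPullback φ.toFun :=
  ⟨((p.1.1.1.1, p.1.1.2.1), p.1.2.map (dSmooth_val (P := (· ∈ B)))),
    congrArg Subtype.val p.2.1, congrArg Subtype.val p.2.2⟩

theorem isSubspaceMap_pathPullbackIncl {A : Set X} {B : Set Y} (φ : PairMap A B) :
    IsSubspaceMap (pathPullbackIncl φ) (pathPullbackSet φ.toFun A B) where
  smooth := by
    have h := dSmooth_pathMap (dSmooth_val (P := (· ∈ B)))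
    unfold pathPullbackIncl
    fun_prop
  injective p q h := by
    have h' := congrArg Subtype.val h
    refine Subtype.ext (Prod.ext (Prod.ext (Subtype.ext ?_) (Subtype.ext ?_)) ?_)
    · exact congrArg (fun x => x.1.1) h'
    · exact congrArg (fun x => x.1.2) h'
    · exact (isSubspaceMap_path B).injective (congrArg (fun x => x.2) h')
  mem p := ⟨p.1.1.1.2, p.1.1.2.2, fun s => (p.1.2.toFun s).2⟩
  exists_lift {W} _ f hf hA := by
    obtain ⟨γ, hγ, e⟩ := (isSubspaceMap_path B).exists_lift (fun w => (f w).1.2)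
      (by fun_prop) (fun w => (hA w).2.2)
    have e' : ∀ w s, ((γ w).toFun s : Y) = (f w).1.2.toFun s :=
      fun w s => congrFun (congrArg SPath.toFun (e w)) s
    refine ⟨fun w => ⟨((⟨(f w).1.1.1, (hA w).1⟩, ⟨(f w).1.1.2, (hA w).2.1⟩), γ w),
      Subtype.ext ((e' w 0).trans (f w).2.1), Subtype.ext ((e' w 1).trans (f w).2.2)⟩, ?_, ?_⟩
    · fun_prop
    · intro w
      exact Subtype.ext (Prod.ext rfl (e w))

/-- The map of pairs given by `pathPullbackMap`. -/
def pathPairMap {A : Set X} {B : Set Y} (φ : PairMap A B) :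
    PairMap (pathSet A) (pathPullbackSet φ.toFun A B) where
  toFun := pathPullbackMap φ.smooth
  smooth := dSmooth_pathPullbackMap φ.smooth
  mapsTo _ h := ⟨h 0, h 1, fun s => φ.mapsTo (h s)⟩

theorem PairMap.IsNEquivalence.hasPairLifting_path_univ {A : Set X} {B : Set Y} {N : ℕ}
    {φ : PairMap A B} (hφ : φ.IsNEquivalence N) (hn : n + 1 ≤ N) :
    HasPairLifting n (pathPairMap φ).toFun Set.univ Set.univ :=
  ((hφ.1.hasCubeLifting hn).path φ.smooth).hasPairLifting_univ

theorem PairMap.IsNEquivalence.hasPairLifting_path {A : Set X} {B : Set Y} {N : ℕ}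
    {φ : PairMap A B} (hφ : φ.IsNEquivalence N) (hn : n + 1 ≤ N) :
    HasPairLifting n (pathPairMap φ).toFun (pathSet A) (pathPullbackSet φ.toFun A B) :=
  ((hφ.2.hasCubeLifting hn).path hφ.2.smooth).hasPairLifting
    (isSubspaceMap_path A) (isSubspaceMap_pathPullbackIncl φ) fun _ => rfl

end PathPair

/-! ### Cells of a subcomplex -/

section Cells

variable {Z : Type u} [DiffeologicalSpace Z] {D : Set Z}

theorem RelCWComplex.char_boundary (K : RelCWComplex Z D) {n : ℕ} (e : K.cell n)
    (t : cubeBoundary n) : (K.char n e t : Z) = K.attach n e t :=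
  (congrArg Subtype.val ((K.isPushout n).comm ⟨e, t⟩)).symm

theorem RelCWComplex.skel_mono (K : RelCWComplex Z D) : Monotone K.skel :=
  monotone_nat_of_le_succ K.skel_subset

theorem RelCWComplex.mem_skel_succ (K : RelCWComplex Z D) {n : ℕ} {z : Z}
    (hz : z ∈ K.skel (n + 1)) : z ∈ K.skel n ∨ ∃ (e : K.cell n) (t : ICube n),
      t ∉ cubeBoundary n ∧ (K.char n e t : Z) = z := by
  obtain ⟨p | p, hp⟩ := (K.isPushout n).surjective ⟨z, hz⟩
  · left
    have hp' : p.1 = z := congrArg Subtype.val hp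
    exact hp' ▸ p.2
  · have hp' : (K.char n p.1 p.2 : Z) = z := congrArg Subtype.val hp
    by_cases ht : p.2 ∈ cubeBoundary n
    · left
      rw [← hp', K.char_boundary p.1 ⟨p.2, ht⟩]
      exact (K.attach n p.1 _).2
    · exact Or.inr ⟨p.1, p.2, ht, hp'⟩

/-- Interior points of the cube are not glued to anything, by `IsDiffPushout.eq_of_inr`. -/
theorem RelCWComplex.char_notMem_skel (K : RelCWComplex Z D) {n : ℕ} (e : K.cell n)
    {t : ICube n} (ht : t ∉ cubeBoundary n) : (K.char n e t : Z) ∉ K.skel n := by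
  intro h
  have := (K.isPushout n).eq_of_inr (x := ⟨e, t⟩) (p := Sum.inl ⟨_, h⟩)
    (fun a ha => ht (by
      rw [Sigma.mk.injEq] at ha
      have := eq_of_heq ha.2
      exact this ▸ a.2.2)) (Subtype.ext rfl)
  simp at this

theorem RelCWComplex.char_injective (K : RelCWComplex Z D) {n : ℕ} {e e' : K.cell n}
    {t t' : ICube n} (ht : t ∉ cubeBoundary n) (h : (K.char n e t : Z) = K.char n e' t') :
    e = e' := by
  have := (K.isPushout n).eq_of_inr (x := ⟨e, t⟩) (p := Sum.inr ⟨e', t'⟩)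
    (fun a ha => ht (by
      rw [Sigma.mk.injEq] at ha
      have := eq_of_heq ha.2
      exact this ▸ a.2.2)) (Subtype.ext h.symm)
  simp only [Sum.inr.injEq, Sigma.mk.injEq] at this
  exact this.1.symm

/-- A subcomplex contains every cell whose interior it meets. -/
theorem CWComplex.IsSubcomplex.char_mem {K : CWComplex Z} {C : Set Z} (hC : K.IsSubcomplex C)
    {n : ℕ} (e : K.cell n) {t : ICube n} (ht : t ∉ cubeBoundary n) (h : (K.char n e t : Z) ∈ C)
    (t' : ICube n) : (K.char n e t' : Z) ∈ C := by
  obtain ⟨L, hL⟩ := hC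
  have hz : (⟨_, h⟩ : C) ∈ ⋃ n, L.skel n := L.iUnion_skel ▸ trivial
  obtain ⟨m, hm⟩ := Set.mem_iUnion.1 hz
  have key : ∀ m, (⟨_, h⟩ : C) ∈ L.skel m → ∃ (k : ℕ) (eL : L.cell k) (s : ICube k),
      s ∉ cubeBoundary k ∧ (L.char k eL s : C) = ⟨_, h⟩ := by
    intro m
    induction m with
    | zero => intro hm; rw [L.skel_zero] at hm; exact hm.elim
    | succ k ih =>
      intro hm
      rcases L.mem_skel_succ hm with hm | ⟨eL, s, hs, hs'⟩
      · exact ih hm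
      · exact ⟨k, eL, s, hs, hs'⟩
  obtain ⟨k, eL, s, hs, hs'⟩ := key m hm
  obtain ⟨e', he'⟩ := hL k eL
  have hee : (K.char k e' s : Z) = K.char n e t := by rw [← he', hs']
  -- Open cells of different dimensions are disjoint: the higher one would meet a lower skeleton. In
  -- equal dimensions the two cells coincide.
  rcases lt_trichotomy n k with hnk | rfl | hnk
  · exact (K.char_notMem_skel e' hs (hee ▸ K.skel_mono hnk (K.char n e t).2)).elim
  · rw [← K.char_injective hs hee, ← he']
    exact (L.char n eL t' : C).2
  · exact (K.char_notMem_skel e ht (hee ▸ K.skel_mono hnk (K.char k e' s).2)).elim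

end Cells

/-! ### Lifting up to homotopy on a CW complex -/

section Surjective

variable {X : Type*} {Y : Type*} {Z : Type*} [DiffeologicalSpace X] [DiffeologicalSpace Y]
  [DiffeologicalSpace Z] {A : Set X} {B : Set Y} {C : Set Z}

/-- Lifts up to homotopy, over a skeleton, of a map on a smooth CW complex. -/
theorem exists_lift_skel {M : ℕ} {φ : PairMap A B}
    (h₁ : ∀ n ≤ M, HasPairLifting n φ.toFun Set.univ Set.univ)
    (h₂ : ∀ n ≤ M, HasPairLifting n φ.toFun A B) {K : CWComplex Z} (hK : K.IsGathered)
    (hC : K.IsSubcomplex C) (f : PairMap C B) (n : ℕ) (hn : n ≤ M + 1) :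
    ∃ (g : K.skel n → X) (h : K.skel n × unitInterval → Y), DSmooth g ∧ DSmooth h ∧
      (∀ z, h (z, 0) = f.toFun z) ∧ (∀ z, h (z, 1) = φ.toFun (g z)) ∧
      ∀ z, z.1 ∈ C → g z ∈ A ∧ ∀ s, h (z, s) ∈ B := by
  induction n with
  | zero =>
    have hE : ∀ z : K.skel 0, False := fun z => by
      exact (Set.ext_iff.1 K.skel_zero z.1).1 z.2
    exact ⟨fun z => (hE z).elim, fun q => (hE q.1).elim,
      fun n p hp => (hE (p 0)).elim, fun n p hp => (hE (p 0).1).elim,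
      fun z => (hE z).elim, fun z => (hE z).elim, fun z => (hE z).elim⟩
  | succ n ih =>
    obtain ⟨g, h, hg, hh, hh₀, hh₁, hgh⟩ := ih (by omega)
    have hf := f.smooth
    have hφ := φ.smooth
    have hatt : ∀ e, DSmooth (K.attach n e) := fun e =>
      (K.isPushout n).smooth_left.comp (dSmooth_sigmaMk e)
    have hchar : ∀ e, DSmooth (K.char n e) := fun e =>
      (K.isPushout n).smooth_inr.comp (dSmooth_sigmaMk e)
    have cellwise : ∀ e : K.cell n, ∃ (k : ICube n → X) (H : ICube n × unitInterval → Y),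
        DSmooth k ∧ DSmooth H ∧ (∀ t : cubeBoundary n, k t = g (K.attach n e t)) ∧
        (∀ t, H (t, 0) = f.toFun (K.char n e t)) ∧ (∀ t, H (t, 1) = φ.toFun (k t)) ∧
        (∀ (t : cubeBoundary n) s, H (t.1, s) =
          concat (fun q => f.toFun (K.char n e q.1.1)) (concat (fun q => h (K.attach n e q.1, q.2))
            (fun q => φ.toFun (g (K.attach n e q.1)))) (t, s)) ∧
        ((∀ t, (K.char n e t : Z) ∈ C) → (∀ t, k t ∈ A) ∧ ∀ q, H q ∈ B) := by
      intro e
      have hatt' := hatt e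
      have hchar' := hchar e
      have hf' : DSmooth (fun t => f.toFun (K.char n e t)) := by fun_prop
      have hg' : DSmooth (fun t => g (K.attach n e t)) := by fun_prop
      have hh' : DSmooth (fun q : cubeBoundary n × unitInterval => h (K.attach n e q.1, q.2)) := by
        fun_prop
      have ht : IsTame (fun t => (g (K.attach n e t), fun s => h (K.attach n e t, s))) :=
        (hK n e).comp fun z => (g z, fun s => h (z, s))
      have e₀ : ∀ t : cubeBoundary n, h (K.attach n e t, 0) = f.toFun (K.char n e t.1) :=
        fun t => by rw [hh₀, K.char_boundary]
      -- A cell not contained in `C` meets it at most in boundary points, so its interior is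
      -- unconstrained.
      by_cases he : ∀ t, (K.char n e t : Z) ∈ C
      · have hb : ∀ t, (K.attach n e t : Z) ∈ C := fun t => by
          rw [← K.char_boundary]; exact he _
        obtain ⟨k, H, hk, hH, hkA, hHB, a, b, c, d⟩ := h₂ n (by omega) _ _ _ hf' hg' hh' ht
          (fun t => f.mapsTo (he t)) (fun t => (hgh _ (hb t)).1)
          (fun q => (hgh _ (hb q.1)).2 q.2) e₀ (fun t => hh₁ _)
        exact ⟨k, H, hk, hH, a, b, c, d, fun _ => ⟨hkA, hHB⟩⟩
      · obtain ⟨k, H, hk, hH, -, -, a, b, c, d⟩ := h₁ n (by omega) _ _ _ hf' hg' hh' ht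
          (fun t => trivial) (fun t => trivial) (fun q => trivial) e₀ (fun t => hh₁ _)
        exact ⟨k, H, hk, hH, a, b, c, d, fun h => (he h).elim⟩
    choose k H hk hH hkg hH₀ hH₁ hHb hkH using cellwise
    -- On the lower skeleton `h` is replaced by this reparametrization, whose boundary values match
    -- those of every cell. Successive homotopies thus need not restrict to each other, which is
    -- harmless for finitely many skeleta.
    have hc : DSmooth (concat (fun q : K.skel n × unitInterval => f.toFun q.1)
        (concat h (fun q => φ.toFun (g q.1)))) := by
      refine dSmooth_concat (by fun_prop) (dSmooth_concat hh (by fun_prop) fun z => ?_) fun z => ?_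
      · exact hh₁ z
      · rw [concat_zero, hh₀]
    obtain ⟨g', hg', g₁, g₂⟩ := (K.isPushout n).exists_desc hg
      (u₂ := fun p => k p.1 p.2) (dSmooth_sigma fun e => hk e) (fun a => (hkg a.1 a.2).symm)
    -- Curried homotopies are glued as maps into `SPath Y`; no pushout property of the product with
    -- I is needed.
    obtain ⟨h', hh', k₁, k₂⟩ := (K.isPushout n).exists_desc (dSmooth_curryPath hc)
      (u₂ := fun p => curryPath (H p.1) (hH p.1) p.2)
      (dSmooth_sigma fun e => dSmooth_curryPath (hH e)) (fun a => SPath.ext (funext fun s => by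
        simp only [curryPath]
        rw [hHb]
        simp only [concat, ← K.char_boundary]))
    have val : ∀ z : K.skel (n + 1), (∃ y : K.skel n, z = Set.inclusion (K.skel_subset n) y) ∨
        ∃ (e : K.cell n) (t : ICube n), t ∉ cubeBoundary n ∧ z = K.char n e t := by
      intro z
      rcases K.mem_skel_succ z.2 with hz | ⟨e, t, ht, hz⟩
      · exact Or.inl ⟨⟨z, hz⟩, rfl⟩
      · exact Or.inr ⟨e, t, ht, Subtype.ext hz.symm⟩
    have g₂' : ∀ e t, g' (K.char n e t) = k e t := fun e t => g₂ ⟨e, t⟩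
    have k₂' : ∀ e t, h' (K.char n e t) = curryPath (H e) (hH e) t := fun e t => k₂ ⟨e, t⟩
    refine ⟨g', fun q => (h' q.1).toFun q.2, hg', by fun_prop, fun z => ?_, fun z => ?_,
      fun z hz => ?_⟩
    · rcases val z with ⟨y, rfl⟩ | ⟨e, t, -, rfl⟩
      · simp only [k₁, curryPath, concat_zero]
      · simp only [k₂', curryPath, hH₀]
    · rcases val z with ⟨y, rfl⟩ | ⟨e, t, -, rfl⟩
      · simp only [k₁, curryPath, concat_one, g₁]
      · simp only [k₂', curryPath, hH₁, g₂']
    · rcases val z with ⟨y, rfl⟩ | ⟨e, t, ht, rfl⟩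
      · have hy : y.1 ∈ C := hz
        refine ⟨by rw [g₁]; exact (hgh y hy).1, fun s => ?_⟩
        simp only [k₁, curryPath, concat]
        split_ifs
        · exact f.mapsTo hy
        · exact (hgh y hy).2 _
        · exact φ.mapsTo (hgh y hy).1
      · have he := hkH e (hC.char_mem e ht hz)
        refine ⟨by rw [g₂']; exact he.1 t, fun s => ?_⟩
        simp only [k₂', curryPath]
        exact he.2 _

theorem surjective_inducedMap {M : ℕ} {φ : PairMap A B}
    (h₁ : ∀ n ≤ M, HasPairLifting n φ.toFun Set.univ Set.univ)
    (h₂ : ∀ n ≤ M, HasPairLifting n φ.toFun A B) {K : CWComplex Z} (hK : K.IsGathered)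
    (hC : K.IsSubcomplex C) (hM : K.DimLE M) : Function.Surjective (inducedMap C φ) := by
  intro b
  obtain ⟨f, rfl⟩ := Quotient.exists_rep b
  obtain ⟨g, h, hg, hh, hh₀, hh₁, hgh⟩ := exists_lift_skel h₁ h₂ hK hC f (M + 1) le_rfl
  have hmem : ∀ z : Z, z ∈ K.skel (M + 1) := fun z => by
    rw [show K.skel (M + 1) = Set.univ from hM]; trivial
  let k : PairMap C A := ⟨fun z => g ⟨z, hmem z⟩, by fun_prop, fun z hz => (hgh ⟨z, _⟩ hz).1⟩
  refine ⟨Quotient.mk _ k, Quotient.sound ((homotopySetoid C B).symm ?_)⟩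
  exact ⟨fun q => h (⟨q.1, hmem q.1⟩, q.2), by fun_prop, fun z => hh₀ _, fun z => hh₁ _,
    fun z hz s => (hgh ⟨z, _⟩ hz).2 s⟩

/-- The lift `k` is a homotopy between its end point maps, and the first two components of `H` join
these to `f₀` and `f₁`. -/
theorem injective_inducedMap {φ : PairMap A B}
    (h : Function.Surjective (inducedMap C (pathPairMap φ))) :
    Function.Injective (inducedMap C φ) := by
  intro a b hab
  obtain ⟨f₀, rfl⟩ := Quotient.exists_rep a
  obtain ⟨f₁, rfl⟩ := Quotient.exists_rep b
  obtain ⟨F, hF, hF₀, hF₁, hFC⟩ := Quotient.exact hab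
  have hf₀ := f₀.smooth
  have hf₁ := f₁.smooth
  have hc := dSmooth_curryPath hF
  let f : PairMap C (pathPullbackSet φ.toFun A B) :=
    ⟨fun z => ⟨((f₀.toFun z, f₁.toFun z), curryPath F hF z), hF₀ z, hF₁ z⟩, by fun_prop,
      fun z hz => ⟨f₀.mapsTo hz, f₁.mapsTo hz, fun s => hFC z hz s⟩⟩
  obtain ⟨k, hk⟩ := h (Quotient.mk _ f)
  obtain ⟨k, rfl⟩ := Quotient.exists_rep k
  obtain ⟨H, hH, hH₀, hH₁, hHC⟩ := Quotient.exact hk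
  have hks := k.smooth
  let k₀ : PairMap C A := ⟨fun z => (k.toFun z).toFun 0, by fun_prop, fun z hz => k.mapsTo hz 0⟩
  let k₁ : PairMap C A := ⟨fun z => (k.toFun z).toFun 1, by fun_prop, fun z hz => k.mapsTo hz 1⟩
  have e₀ : (homotopySetoid C A).r k₀ f₀ :=
    ⟨fun q => (H q).1.1.1, by fun_prop, fun z => by simp only [hH₀]; rfl,
      fun z => by simp only [hH₁]; rfl, fun z hz s => (hHC z hz s).1⟩
  have e₁ : (homotopySetoid C A).r k₁ f₁ :=
    ⟨fun q => (H q).1.1.2, by fun_prop, fun z => by simp only [hH₀]; rfl,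
      fun z => by simp only [hH₁]; rfl, fun z hz s => (hHC z hz s).2.1⟩
  have e : (homotopySetoid C A).r k₀ k₁ :=
    ⟨fun q => (k.toFun q.1).toFun q.2, by fun_prop, fun z => rfl, fun z => rfl,
      fun z hz s => k.mapsTo hz s⟩
  exact Quotient.sound ((homotopySetoid C A).trans ((homotopySetoid C A).symm e₀)
    ((homotopySetoid C A).trans e e₁))

end Surjective

end SmoothHomotopy

end

/-! ### The proposition -/

open SmoothHomotopy
theorem mainTheorem5 {X : Type*} {Y : Type*} {Z : Type*}
    [DiffeologicalSpace X] [DiffeologicalSpace Y] [DiffeologicalSpace Z]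
    {A : Set X} {B : Set Y} {C : Set Z} (N : ℕ)
    (φ : PairMap A B) (hφ : φ.IsNEquivalence N)
    (K : CWComplex Z) (hK : K.IsGathered) (hC : CWComplex.IsSubcomplex K C) :
    (K.DimLT N → Function.Injective (inducedMap C φ)) ∧
      (K.DimLE N → Function.Surjective (inducedMap C φ)) := by
  refine ⟨fun hN => ?_, fun hN => surjective_inducedMap (fun n hn => hφ.hasPairLifting_univ hn)
    (fun n hn => hφ.hasPairLifting hn) hK hC hN⟩
  cases N with
  | zero =>
    -- For N = 0, `Z` equals its (-1)-skeleton and is empty.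
    have hE : ∀ z : Z, False := fun z => by
      have h : z ∈ K.skel 0 := by rw [show K.skel 0 = Set.univ from hN]; trivial
      rw [K.skel_zero] at h
      exact h
    intro a b _
    obtain ⟨f₀, rfl⟩ := Quotient.exists_rep a
    obtain ⟨f₁, rfl⟩ := Quotient.exists_rep b
    exact Quotient.sound ⟨fun q => (hE q.1).elim, fun n p hp => (hE (p 0).1).elim,
      fun z => (hE z).elim, fun z => (hE z).elim, fun z => (hE z).elim⟩
  | succ M =>
    -- For N = M + 1, `DimLT N` is `DimLE M`, and path space problems on Iⁿ with n ≤ M use cubes of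
    -- dimension n + 1 ≤ N.
    exact injective_inducedMap (surjective_inducedMap
      (fun n hn => hφ.hasPairLifting_path_univ (by omega))
      (fun n hn => hφ.hasPairLifting_path (by omega)) hK hC hN)
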